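/- Conventions. Alphabets are finite; $\Sigma^*$ is the set of words over $\Sigma$. A function $g\colon\Sigma^*\to\mathbb N$ is - an *$\mathbb N$-rational series* if it is computed by a finite automaton with weights in $\mathbb N$: $g(w)$ is the sum, over all runs reading $w$, of the product of the initial weight, the transition weights and the final weight of the run; - *$\mathbb N$-polyregular* if there are $d\in\mathbb N$, a finite monoid $M$, a monoid morphism $\mu\colon\Sigma^*\to M$ and a map $\pi\colon M^{d+1}\to\mathbb N$ such that $g(w)=\sum_{w=u_1\cdots u_{d+1}}\pi(\mu(u_1),\dots,\mu(u_{d+1}))$ for all $w$, where the sum ranges over all factorizations of $w$ into $d+1$ possibly empty words; it is *star-free $\mathbb N$-polyregular* if moreover $M$ can be chosen aperiodic (for every $x\in M$ there is $n \in \mathbb N$ with $x^{n+1}=x^n$). A polynomial $P\in\mathbb Q[X_1,\dots,X_k]$ is *represented* by $g\colon\Sigma^*\to\mathbb N$ if $g$ is commutative (invariant under permuting the letters of its input) and there is a map $\eta\colon\{1,\dots,k\}\to\Sigma$ with $g(\eta(1)^{x_1}\cdots\eta(k)^{x_k})=P(x_1,\dots,x_k)$ for all $x\in\mathbb N^k$.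 For a partial function $\nu$ from the indeterminates to $\mathbb N$, $P|_\nu$ denotes the polynomial in the remaining indeterminates that is obtained from $P$ by substituting $\nu(X_i)$ for each $X_i\in\operatorname{dom}\nu$. A *maximal monomial* of a polynomial is one of its (nonzero) monomials that is maximal for divisibility (over $\mathbb Q$) among its monomials. $\mathsf{PolyStrNNeg}$ is the class of polynomials $P$ with integer coefficients such that, for every $\nu$, all maximal monomials of $P|_\nu$ have a non-negative coefficient. $P \in \mathbb Q[X_1,\dots,X_k]$ is *integer-valued* if $P(\mathbb Z^k)\subseteq\mathbb Z$. A *natural binomial polynomial* is a finite linear combination, with coefficients in $\mathbb N$, of products $\prod_j \left[{X_j-p_j\atop k_j}\right]$ with $p_j,k_j\in\mathbb N$, where $\left[{X-p\atop k}\right]=\frac{1}{k!}(X-p)(X-p-1)\cdots(X-p-k+1)$. $P$ is a *strongly natural binomial polynomial* if $P|_\nu$ is a natural binomial polynomial for every $\nu$. **Theorem.** Let $k\in\mathbb N$, let $P\in\mathbb Q[X_1,\dots,X_k]$, and let $\alpha$ be the smallest positive integer such that $\alpha P\in\mathbb Z[X_1,\dots,X_k]$. The following are equivalent: 1. $\alpha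 P\in\mathsf{PolyStrNNeg}$ and $P$ is integer-valued; 2. $P$ is represented by an $\mathbb N$-rational series; 3. $P$ is represented by an $\mathbb N$-polyregular function; 4. $P$ is represented by a star-free $\mathbb N$-polyregular function; 5. $P$ is a strongly natural binomial polynomial. Moreover, each of these properties is decidable: there is an algorithm that, given $k$ and $P$ (as a list of terms with rational coefficients and exponents), decides whether the property holds. -/

import Mathlib

namespace NRatPoly

/-! ### Polynomials -/

section Polynomials

variable {σ : Type*} {R : Type*}

/-- The restriction `P|ν` of a polynomial along a partial valuation `ν : σ ⇀ ℕ` of the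
indeterminates: the indeterminates in the domain of `ν` are replaced by their values, and the
result is a polynomial in the remaining ones. -/
noncomputable def restrict [CommSemiring R] (ν : σ → Option ℕ) (P : MvPolynomial σ R) :
    MvPolynomial {i // ν i = none} R :=
  MvPolynomial.bind₁
    (fun i => match h : ν i with
      | some n => MvPolynomial.C (n : R)
      | none => MvPolynomial.X ⟨i, h⟩) P

/-- `s` is the exponent of a maximal monomial of `P`: it occurs in `P` (with a nonzero
coefficient), and is maximal for divisibility among the monomials of `P`. Over `ℚ`, nonzero scalars
are irrelevant for divisibility, so that divisibility is the componentwise order on exponents. -/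
def IsMaximalMonomial [CommSemiring R] (P : MvPolynomial σ R) (s : σ →₀ ℕ) : Prop :=
  Maximal (fun t => t ∈ P.support) s

/-- The class `PolyStrNNeg`: all maximal monomials of all restrictions are non-negative. -/
def PolyStrNNeg (P : MvPolynomial σ ℤ) : Prop :=
  ∀ (ν : σ → Option ℕ) (s : {i // ν i = none} →₀ ℕ),
    IsMaximalMonomial (restrict ν P) s → 0 ≤ (restrict ν P).coeff s

/-- `a` is a positive integer such that `a P` has integer coefficients. -/
def IsDenominator (P : MvPolynomial σ ℚ) (a : ℕ) : Prop :=
  1 ≤ a ∧ ∃ Q : MvPolynomial σ ℤ, MvPolynomial.map (Int.castRingHom ℚ) Q = (a : ℚ) • P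

/-- The least positive integer `α` such that `α P` has integer coefficients. -/
noncomputable def leastDenominator (P : MvPolynomial σ ℚ) : ℕ :=
  sInf {a : ℕ | IsDenominator P a}

theorem exists_isDenominator (P : MvPolynomial σ ℚ) : ∃ a, IsDenominator P a := by
  classical
  induction P using MvPolynomial.induction_on' with
  | monomial u a =>
    refine ⟨a.den, a.den_pos, MvPolynomial.monomial u a.num, ?_⟩
    rw [MvPolynomial.map_monomial, MvPolynomial.smul_monomial]
    congr 1
    simp [Rat.den_mul_eq_num]
  | add p q hp hq =>
    obtain ⟨a, ha, A, hA⟩ := hp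
    obtain ⟨b, hb, B, hB⟩ := hq
    refine ⟨a * b, Nat.mul_pos ha hb, (b : ℤ) • A + (a : ℤ) • B, ?_⟩
    rw [map_add, map_zsmul, map_zsmul, hA, hB, ← Int.cast_smul_eq_zsmul ℚ,
      ← Int.cast_smul_eq_zsmul ℚ, smul_add, smul_smul, smul_smul]
    push_cast
    rw [mul_comm (b : ℚ)]

/-- The number `leastDenominator P` is indeed the least positive integer as above. -/
theorem leastDenominator_isLeast (P : MvPolynomial σ ℚ) :
    IsLeast {a : ℕ | IsDenominator P a} (leastDenominator P) :=
  ⟨Nat.sInf_mem (exists_isDenominator P), fun _ ha => Nat.sInf_le ha⟩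

/-- `α P` belongs to `PolyStrNNeg`, where `α` is the least denominator of `P`. -/
def ScaledPolyStrNNeg (P : MvPolynomial σ ℚ) : Prop :=
  ∃ Q : MvPolynomial σ ℤ,
    MvPolynomial.map (Int.castRingHom ℚ) Q = (leastDenominator P : ℚ) • P ∧ PolyStrNNeg Q

/-- `P` takes integer values at all integer points. -/
def IntegerValued (P : MvPolynomial σ ℚ) : Prop :=
  ∀ x : σ → ℤ, ∃ m : ℤ, MvPolynomial.eval (fun i => (x i : ℚ)) P = m

/-- The binomial monomial `(X - l) (X - l - 1) ⋯ (X - l - k + 1) / k!`, where `X` is the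
indeterminate of index `i`. -/
noncomputable def binomialMonomial (i : σ) (l k : ℕ) : MvPolynomial σ ℚ :=
  MvPolynomial.C (1 / (k.factorial : ℚ)) *
    ∏ t ∈ Finset.range k, (MvPolynomial.X i - MvPolynomial.C ((l : ℚ) + (t : ℚ)))

/-- Natural binomial polynomials: `ℕ`-linear combinations of products of binomial monomials. -/
def IsNaturalBinomial [Fintype σ] (P : MvPolynomial σ ℚ) : Prop :=
  ∃ (n : ℕ) (c : Fin n → ℕ) (p κ : Fin n → σ → ℕ),
    P = ∑ r : Fin n, (c r : ℚ) • ∏ j : σ, binomialMonomial j (p r j) (κ r j)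

/-- Strongly natural binomial polynomials: all restrictions are natural binomial polynomials. -/
def IsStronglyNaturalBinomial [Fintype σ] (P : MvPolynomial σ ℚ) : Prop :=
  ∀ ν : σ → Option ℕ, IsNaturalBinomial (restrict ν P)

end Polynomials

/-! ### Rational series and polyregular functions -/

/-- A weighted automaton with finitely many states over the alphabet `A`, with weights in `S`. -/
structure WeightedAutomaton (S A : Type) where
  State : Type
  [fintypeState : Fintype State]
  /-- initial weights -/
  init : State → S
  /-- `trans q a q'` is the weight of the transition from `q` to `q'` reading `a` -/
  trans : State → A → State → S
  /-- final weights -/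
  final : State → S

attribute [instance] WeightedAutomaton.fintypeState

/-- The value of a weighted automaton on a word `w`: the sum over all runs `ρ` reading `w`, of the
product of the weights along the run (including the initial and final weights). -/
def WeightedAutomaton.value {S A : Type} [CommSemiring S] (𝒜 : WeightedAutomaton S A)
    (w : List A) : S :=
  ∑ ρ : Fin (w.length + 1) → 𝒜.State,
    𝒜.init (ρ 0) * (∏ i : Fin w.length, 𝒜.trans (ρ i.castSucc) (w.get i) (ρ i.succ)) *
      𝒜.final (ρ (Fin.last w.length))

/-- `ℕ`-rational series over the alphabet `A`. -/
def IsNRational (A : Type) (f : List A → ℕ) : Prop :=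
  ∃ 𝒜 : WeightedAutomaton ℕ A, ∀ w, f w = 𝒜.value w

theorem finite_factorizations {A : Type} (n : ℕ) (w : List A) :
    {u : Fin n → List A | (List.ofFn u).flatten = w}.Finite := by
  have hfin : {v : List A | v <:+: w}.Finite := by
    refine (List.finite_toSet w.sublists).subset fun v hv => ?_
    simpa using List.IsInfix.sublist hv
  refine (Set.Finite.pi' fun _ : Fin n => hfin).subset ?_
  rintro u rfl i
  exact List.infix_of_mem_flatten (List.mem_ofFn.2 ⟨i, rfl⟩)

/-- The finite set of all factorizations `w = u₁ ⋯ uₙ` into `n` possibly empty words. -/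
noncomputable def factorizations {A : Type} (n : ℕ) (w : List A) : Finset (Fin n → List A) :=
  (finite_factorizations n w).toFinset

/-- `f(w) = ∑_{w = u₁ ⋯ u_{d+1}} π(μ(u₁), …, μ(u_{d+1}))` for all words `w`. -/
def IsComputedBy {A M : Type} [Monoid M] (d : ℕ) (μ : FreeMonoid A →* M)
    (π : (Fin (d + 1) → M) → ℕ) (f : List A → ℕ) : Prop :=
  ∀ w, f w = ∑ u ∈ factorizations (d + 1) w, π (fun i => μ (FreeMonoid.ofList (u i)))

/-- `ℕ`-polyregular functions (of any degree) over the alphabet `A`. -/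
def IsNPolyregular (A : Type) (f : List A → ℕ) : Prop :=
  ∃ (d : ℕ) (M : Type) (_ : Monoid M) (_ : Finite M) (μ : FreeMonoid A →* M)
    (π : (Fin (d + 1) → M) → ℕ), IsComputedBy d μ π f

/-- A monoid is aperiodic if every element `x` satisfies `x ^ (n + 1) = x ^ n` for some `n`. -/
def IsAperiodic (M : Type) [Monoid M] : Prop :=
  ∀ x : M, ∃ n : ℕ, x ^ (n + 1) = x ^ n

/-- Star-free `ℕ`-polyregular functions (of any degree) over the alphabet `A`. -/
def IsStarFreeNPolyregular (A : Type) (f : List A → ℕ) : Prop :=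
  ∃ (d : ℕ) (M : Type) (_ : Monoid M) (_ : Finite M) (μ : FreeMonoid A →* M)
    (π : (Fin (d + 1) → M) → ℕ), IsAperiodic M ∧ IsComputedBy d μ π f

/-! ### Representation of polynomials -/

/-- `f` is invariant under permutations of the letters of its input. -/
def IsCommutative {A X : Type} (f : List A → X) : Prop :=
  ∀ u v : List A, u.Perm v → f u = f v

/-- The word `η(1)^{x₁} ⋯ η(k)^{x_k}`. -/
def dagger {A : Type} {k : ℕ} (η : Fin k → A) (x : Fin k → ℕ) : List A :=
  (List.ofFn fun i => List.replicate (x i) (η i)).flatten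

/-- The function `f : ℕ^k → X` is represented by the commutative function `g : A* → X`. -/
def Represents {A X : Type} {k : ℕ} (g : List A → X) (f : (Fin k → ℕ) → X) : Prop :=
  IsCommutative g ∧ ∃ η : Fin k → A, ∀ x, g (dagger η x) = f x

/-- The polynomial `P`, as a function on `ℕ^k`, is represented by a function of the class `𝓒`
over some finite alphabet. -/
def IsRepresentedIn (𝓒 : ∀ A : Type, (List A → ℕ) → Prop) {k : ℕ}
    (P : MvPolynomial (Fin k) ℚ) : Prop :=
  ∃ (A : Type) (_ : Finite A) (g : List A → ℕ), 𝓒 A g ∧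
    Represents (fun w => (g w : ℚ)) (fun x => MvPolynomial.eval (fun i => (x i : ℚ)) P)

/-! ### Polynomials as inputs of algorithms -/

/-- Finite data for a polynomial over `ℚ`: the number of indeterminates, and a list of terms, each
of which consists of a coefficient, given by a pair `(a, b)` standing for the fraction
`a / (b + 1)`, and of the list of the exponents. -/
abbrev PolyCode : Type := ℕ × List ((ℤ × ℕ) × List ℕ)

/-- The polynomial described by a code, in the indeterminates `X_0, …, X_{k-1}`. Missing exponents
count as `0`, superfluous ones are ignored. -/
noncomputable def PolyCode.toPoly (c : PolyCode) : MvPolynomial (Fin c.1) ℚ :=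
  (c.2.map fun t => MvPolynomial.monomial
    (Finsupp.equivFunOnFinite.symm fun i : Fin c.1 => t.2.getD i.val 0)
    ((t.1.1 : ℚ) / ((t.1.2 : ℚ) + 1))).sum

/-- Every polynomial has a code. -/
theorem PolyCode.exists_toPoly_eq {k : ℕ} (P : MvPolynomial (Fin k) ℚ) :
    ∃ l : List ((ℤ × ℕ) × List ℕ), PolyCode.toPoly (k, l) = P := by
  classical
  induction P using MvPolynomial.induction_on' with
  | monomial u a =>
    refine ⟨[((a.num, a.den - 1), List.ofFn u)], ?_⟩
    have hden : ((a.den - 1 : ℕ) : ℚ) + 1 = a.den := by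
      have := a.den_pos
      exact_mod_cast Nat.sub_add_cancel this
    have hu : (Finsupp.equivFunOnFinite.symm fun i : Fin k => (List.ofFn u).getD i.val 0) = u := by
      ext i
      simp
    simp only [PolyCode.toPoly, List.map_cons, List.map_nil, List.sum_cons, List.sum_nil, add_zero,
      hden, Rat.num_div_den]
    rw [hu]
  | add p q hp hq =>
    obtain ⟨l, rfl⟩ := hp
    obtain ⟨m, rfl⟩ := hq
    exact ⟨l ++ m, by simp [PolyCode.toPoly]⟩

/-- A property of polynomials over `ℚ` (in any number of indeterminates) is decidable if there is
an algorithm which, given (a code of) a polynomial, decides whether it has the property. -/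
def IsDecidable (p : ∀ k : ℕ, MvPolynomial (Fin k) ℚ → Prop) : Prop :=
  ComputablePred fun c : PolyCode => p c.1 c.toPoly

end NRatPoly

open NRatPoly

namespace NRatPoly

/-! ### Newton coefficients of powers -/

/-! The central objects are the mixed differences `Δ^a P (K)`, called `newtonFun a K P`: they are
the coefficients of the Newton expansion of `P` around `K`. All conditions of the theorem are
compared with positivity and integrality of these numbers.

From 1 to 5 and 4. If the maximal monomials of `P` have non-negative coefficients, then for large
`K` every difference of `P` at `(K, …, K)` is non-negative. Indeed, `Δ^a` kills the monomials not
above `a`, and among the others those of largest total degree are maximal in `P`, hence have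
positive coefficients, and dominate (`eventually_newtonFun_nonneg`). Integrality at integer points
makes the differences integers. Applied to each restriction, this yields natural binomial
expansions. Applied to all restrictions simultaneously (`exists_uniform_newtonFun_nonneg`), it
yields one threshold `K` such that `P` is an `ℕ`-combination of products of one-variable functions,
each being either the indicator of a value below `K`, or a binomial coefficient in `x - K` supported
on `x ≥ K` (`eval_eq_sum_pieceFun`). Such products are star-free polyregular: the conditions are
read off letter counts truncated at a threshold, which live in an aperiodic monoid, and the binomial
coefficients count choices of positions (`computedAlong_binomialCount`).

From 4 to 3 nothing is to be done. From 3 to 2, the left derivatives of a polyregular function stay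
in a finitely generated `ℕ`-module (`nonempty_derivativeFamily_polySum`).

From 2 to 1. A non-negative integer matrix `A` admits a step `N` such that `A ^ x * (A ^ N - 1) ^ s`
is entrywise non-negative for large `x` (`exists_pow_mul_sub_pow_nonneg`). So suitable mixed
differences of a represented polynomial are non-negative; at the order given by a maximal monomial
of a restriction, such a difference is a positive multiple of the coefficient of that monomial.
Integrality on `ℕ^k` extends to `ℤ^k` by the Newton expansion at `0`.

From 5 to 1, the leading monomials of an `ℕ`-combination of binomial products cannot cancel.

Decidability. Both property 1 and its negation have certificates that can be checked primitive
recursively: a threshold `K` with natural piece coefficients on one side; a non-integral value or a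
negative maximal coefficient on the other. Post's theorem concludes. -/

/-- `newtonCoeff K t a` is the `a`-th iterated difference of `x ↦ x ^ t` at `K`. -/
def newtonCoeff (K : ℕ) : ℕ → ℕ → ℕ
  | 0, 0 => 1
  | 0, _ + 1 => 0
  | t + 1, 0 => K * newtonCoeff K t 0
  | t + 1, a + 1 => (a + 1) * newtonCoeff K t a + (K + a + 1) * newtonCoeff K t (a + 1)

theorem newtonCoeff_zero_right (K t : ℕ) : newtonCoeff K t 0 = K ^ t := by
  induction t with
  | zero => rfl
  | succ t ih => rw [newtonCoeff, ih, pow_succ']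

theorem newtonCoeff_eq_zero {K t a : ℕ} (h : t < a) : newtonCoeff K t a = 0 := by
  induction t generalizing a with
  | zero => obtain ⟨b, rfl⟩ := Nat.exists_eq_succ_of_ne_zero (by omega : a ≠ 0); rfl
  | succ t ih =>
    obtain ⟨b, rfl⟩ := Nat.exists_eq_succ_of_ne_zero (by omega : a ≠ 0)
    rw [Nat.succ_eq_add_one, newtonCoeff, ih (by omega), ih (by omega)]
    simp

/-- This is `Δ^(a+1) f (K) = Δ^a f (K+1) - Δ^a f (K)` written without subtraction; it identifies the
recursion, which is the Leibniz rule for `x * x ^ t`, with iterated differences. -/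
theorem newtonCoeff_succ_base (K t a : ℕ) :
    newtonCoeff (K + 1) t a = newtonCoeff K t a + newtonCoeff K t (a + 1) := by
  induction t generalizing a with
  | zero => cases a <;> rfl
  | succ t ih =>
    cases a with
    | zero => simp only [newtonCoeff, ih]; ring
    | succ a => simp only [newtonCoeff, ih]; ring

/-- Newton's forward formula for `Δ^a x^t`, obtained by iterating the previous identity. All
coefficients are natural numbers, so positivity at `K` propagates to `K + n`. -/
theorem newtonCoeff_add_base (K n t a : ℕ) :
    newtonCoeff (K + n) t a =
      ∑ j ∈ Finset.range (n + 1), n.choose j * newtonCoeff K t (a + j) := by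
  induction n generalizing a with
  | zero => simp
  | succ n ih =>
    rw [← add_assoc, newtonCoeff_succ_base, ih, ih, Finset.sum_range_succ' _ (n + 1)]
    simp only [Nat.choose_succ_succ, add_mul, Finset.sum_add_distrib, Nat.choose_zero_right,
      one_mul, add_zero]
    rw [Finset.sum_range_succ' (fun j => n.choose j * newtonCoeff K t (a + j)),
      Finset.sum_range_succ (fun j => n.choose (j + 1) * newtonCoeff K t (a + (j + 1)))]
    simp only [Nat.choose_succ_self, Nat.choose_zero_right, add_zero, one_mul, zero_mul]
    have : ∀ j, a + 1 + j = a + (j + 1) := fun j => by ring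
    simp only [this]
    ring

theorem pow_eq_sum_newtonCoeff {K x : ℕ} (h : K ≤ x) (t : ℕ) {m : ℕ} (hm : t < m) :
    x ^ t = ∑ a ∈ Finset.range m, newtonCoeff K t a * (x - K).choose a := by
  obtain ⟨n, rfl⟩ := Nat.exists_eq_add_of_le h
  rw [← newtonCoeff_zero_right, newtonCoeff_add_base, Nat.add_sub_cancel_left]
  simp only [zero_add]
  have key : ∀ {p q : ℕ}, p ≤ q → (∀ a, p ≤ a → n.choose a * newtonCoeff K t a = 0) →
      ∑ a ∈ Finset.range p, n.choose a * newtonCoeff K t a =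
        ∑ a ∈ Finset.range q, n.choose a * newtonCoeff K t a := by
    intro p q hpq h0
    refine Finset.sum_subset (Finset.range_subset_range.2 hpq) fun a _ ha => h0 a (by simpa using ha)
  simp only [mul_comm (newtonCoeff K t _)]
  rw [key (le_max_left (n + 1) m) fun a ha => by rw [Nat.choose_eq_zero_of_lt ha, zero_mul],
    key (le_max_right (n + 1) m) fun a ha => by
      rw [newtonCoeff_eq_zero (lt_of_lt_of_le hm ha), mul_zero]]

/-- The leading term of `Δ^a x^t` is that of the `a`-th derivative, `t (t-1) ⋯ (t-a+1) K^(t-a)`.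
Multiplying by `K ^ a` avoids the exponent `t - a`, so that `a > t` is covered with limit `0`. -/
theorem tendsto_newtonCoeff (t a : ℕ) :
    Filter.Tendsto (fun K : ℕ => ((K : ℝ) ^ a * newtonCoeff K t a) / (K : ℝ) ^ t) Filter.atTop
      (nhds (t.descFactorial a : ℝ)) := by
  induction t generalizing a with
  | zero =>
    cases a with
    | zero => simp [newtonCoeff]
    | succ a => simp [newtonCoeff]
  | succ t ih =>
    cases a with
    | zero =>
      refine (Filter.tendsto_congr' ?_).1 tendsto_const_nhds
      filter_upwards [Filter.eventually_gt_atTop 0] with K hK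
      have : (K : ℝ) ≠ 0 := by positivity
      rw [newtonCoeff_zero_right]
      push_cast
      field_simp
      simp
    | succ a =>
      have hinv : Filter.Tendsto (fun K : ℕ => 1 + ((a : ℝ) + 1) / (K : ℝ)) Filter.atTop
          (nhds (1 + 0)) :=
        tendsto_const_nhds.add (tendsto_const_div_atTop_nhds_zero_nat _)
      have h := ((ih a).const_mul ((a : ℝ) + 1)).add (hinv.mul (ih (a + 1)))
      have e : ((t + 1).descFactorial (a + 1) : ℝ) =
          ((a : ℝ) + 1) * (t.descFactorial a) + (1 + 0) * (t.descFactorial (a + 1)) := by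
        rw [Nat.succ_descFactorial_succ, Nat.descFactorial_succ]
        rcases le_or_gt a t with h | h
        · push_cast [Nat.cast_sub h]
          ring
        · rw [Nat.descFactorial_of_lt h]
          simp
      rw [e]
      refine h.congr' ?_
      filter_upwards [Filter.eventually_gt_atTop 0] with K hK
      have : (K : ℝ) ≠ 0 := by positivity
      simp only [newtonCoeff]
      push_cast
      field_simp
      ring

/-! ### Product functionals on polynomials -/

section ProdFun

variable {σ : Type*} [Fintype σ] {R A : Type*} [CommSemiring R] [CommSemiring A] [Algebra R A]

/-- The linear map sending each monomial `∏ X_i ^ t_i` to `∏ w i t_i`. -/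
noncomputable def prodFun (w : σ → ℕ → A) : MvPolynomial σ R →ₗ[R] A :=
  (MvPolynomial.basisMonomials σ R).constr R fun t => ∏ i, w i (t i)

theorem prodFun_monomial (w : σ → ℕ → A) (t : σ →₀ ℕ) (c : R) :
    prodFun w (MvPolynomial.monomial t c) = c • ∏ i, w i (t i) := by
  have : MvPolynomial.monomial t c = c • MvPolynomial.basisMonomials σ R t := by
    simp [MvPolynomial.smul_monomial]
  rw [this, map_smul, prodFun, Module.Basis.constr_basis]

theorem prodFun_eq_sum (w : σ → ℕ → A) (P : MvPolynomial σ R) :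
    prodFun w P = ∑ t ∈ P.support, P.coeff t • ∏ i, w i (t i) := by
  conv_lhs => rw [P.as_sum]
  rw [map_sum]
  simp only [prodFun_monomial]

theorem aeval_eq_prodFun (x : σ → A) (P : MvPolynomial σ R) :
    MvPolynomial.aeval x P = prodFun (fun i t => x i ^ t) P := by
  rw [prodFun_eq_sum, MvPolynomial.aeval_def, MvPolynomial.eval₂_eq']
  simp [Algebra.smul_def]

theorem eval_eq_prodFun (x : σ → R) (P : MvPolynomial σ R) :
    MvPolynomial.eval x P = prodFun (fun i t => x i ^ t) P := by
  rw [← aeval_eq_prodFun, MvPolynomial.aeval_eq_eval]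

theorem eq_prodFun_X (P : MvPolynomial σ R) :
    P = prodFun (fun i t => (MvPolynomial.X i : MvPolynomial σ R) ^ t) P := by
  rw [← aeval_eq_prodFun, MvPolynomial.aeval_X_left, AlgHom.id_apply]

/-- Distributivity: decomposing the functional in each variable decomposes the product functional.
Newton expansions, changes of base point, alternating sums and the decomposition into pieces are all
instances. -/
theorem prodFun_expand [DecidableEq σ] {ι : Type*} (J : σ → Finset ι) (v : σ → ι → ℕ → R)
    (c : σ → ι → A) (w : σ → ℕ → A) (P : MvPolynomial σ R)
    (h : ∀ t ∈ P.support, ∀ i, w i (t i) = ∑ j ∈ J i, v i j (t i) • c i j) :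
    prodFun w P =
      ∑ b ∈ Fintype.piFinset J, prodFun (fun i => v i (b i)) P • ∏ i, c i (b i) := by
  simp only [prodFun_eq_sum, Finset.sum_smul]
  rw [Finset.sum_comm]
  refine Finset.sum_congr rfl fun t ht => ?_
  rw [Finset.prod_congr rfl fun i _ => h t ht i, Finset.prod_univ_sum, Finset.smul_sum]
  refine Finset.sum_congr rfl fun b _ => ?_
  rw [smul_eq_mul, mul_smul, Finset.prod_smul]

theorem coeff_eq_prodFun [DecidableEq σ] (s : σ →₀ ℕ) (P : MvPolynomial σ R) :
    P.coeff s = prodFun (fun i t => if t = s i then 1 else 0) P := by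
  classical
  rw [prodFun_eq_sum]
  have : ∀ t : σ →₀ ℕ, (∏ i, if t i = s i then (1 : R) else 0) = if t = s then 1 else 0 := by
    intro t
    rw [Finset.prod_ite_zero]
    simp [Finsupp.ext_iff]
  simp only [this, smul_eq_mul, mul_ite, mul_one, mul_zero, Finset.sum_ite_eq']
  split_ifs with h
  · rfl
  · simpa using h

end ProdFun

/-! ### Product functionals and partial substitution -/

section Restrict

variable {σ : Type*} {R : Type*} [CommSemiring R]

/-- The functional on the exponents of all indeterminates which evaluates those in the domain of
`ν`, and is given by `w` for the others. -/
def extendFun (ν : σ → Option ℕ) (w : {i // ν i = none} → ℕ → R) (i : σ) (t : ℕ) : R :=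
  match h : ν i with
  | some n => (n : R) ^ t
  | none => w ⟨i, h⟩ t

theorem extendFun_some {ν : σ → Option ℕ} {w : {i // ν i = none} → ℕ → R} {i : σ} {n : ℕ}
    (h : ν i = some n) (t : ℕ) : extendFun ν w i t = (n : R) ^ t := by
  unfold extendFun
  split <;> simp_all

theorem extendFun_none {ν : σ → Option ℕ} {w : {i // ν i = none} → ℕ → R} {i : σ}
    (h : ν i = none) (t : ℕ) : extendFun ν w i t = w ⟨i, h⟩ t := by
  unfold extendFun
  split <;> simp_all

/-- Substituting `n` for an indeterminate amounts to using the functional `t ↦ n ^ t` in that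
coordinate. Restrictions can thus be handled inside the original polynomial. -/
theorem prodFun_restrict [Fintype σ] (ν : σ → Option ℕ) (w : {i // ν i = none} → ℕ → R)
    (P : MvPolynomial σ R) : prodFun w (restrict ν P) = prodFun (extendFun ν w) P := by
  classical
  induction P using MvPolynomial.induction_on' with
  | add p q hp hq =>
    rw [map_add, ← hp, ← hq, ← map_add, restrict, restrict, restrict, map_add]
  | monomial t c =>
    have hr : restrict ν (MvPolynomial.monomial t c) =
        MvPolynomial.monomial (Finsupp.equivFunOnFinite.symm fun i : {i // ν i = none} => t i)
          (c * ∏ i : {i // ¬ ν i = none}, extendFun ν w i (t i)) := by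
      rw [restrict, MvPolynomial.bind₁_monomial,
        Finset.prod_subset (Finset.subset_univ _) fun i _ hi => by
          rw [Finsupp.notMem_support_iff.1 hi, pow_zero],
        ← Fintype.prod_subtype_mul_prod_subtype (fun i => ν i = none), MvPolynomial.monomial_eq,
        Finsupp.prod_fintype _ _ fun i => pow_zero _, map_mul, map_prod]
      rw [mul_comm (∏ _, _), mul_assoc]
      congr 2
      · refine Finset.prod_congr rfl fun i _ => ?_
        obtain ⟨n, hn⟩ := Option.ne_none_iff_exists'.1 i.2
        rw [extendFun_some hn, map_pow]
        split <;> simp_all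
      · refine Finset.prod_congr rfl fun i _ => ?_
        have hi := i.2
        split <;> simp_all
    rw [hr, prodFun_monomial, prodFun_monomial,
      ← Fintype.prod_subtype_mul_prod_subtype (fun i => ν i = none)]
    simp only [smul_eq_mul, mul_assoc]
    congr 1
    rw [mul_comm]
    congr 1
    refine Finset.prod_congr rfl fun i _ => ?_
    rw [extendFun_none i.2]
    rfl

end Restrict

/-! ### Positivity and integrality of differences -/

section Positivity

variable {σ : Type*}

/-- All maximal monomials have a non-negative coefficient. -/
def MaximalNonneg (P : MvPolynomial σ ℚ) : Prop :=
  ∀ s, IsMaximalMonomial P s → 0 ≤ P.coeff s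

/-- All maximal monomials of all restrictions have a non-negative coefficient. -/
def StronglyNonneg (P : MvPolynomial σ ℚ) : Prop :=
  ∀ ν : σ → Option ℕ, MaximalNonneg (restrict ν P)

/-- The product functional computing the iterated difference of order `a` at the point `K`. -/
noncomputable def newtonFun [Fintype σ] (a K : σ → ℕ) (P : MvPolynomial σ ℚ) : ℚ :=
  prodFun (fun i t => (newtonCoeff (K i) t (a i) : ℚ)) P

theorem prod_newtonCoeff_eq_zero [Fintype σ] {a K : σ → ℕ} {t : σ →₀ ℕ} (h : ¬ ∀ i, a i ≤ t i) :
    ∏ i, (newtonCoeff (K i) (t i) (a i) : ℚ) = 0 := by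
  push Not at h
  obtain ⟨i, hi⟩ := h
  exact Finset.prod_eq_zero (Finset.mem_univ i) (by rw [newtonCoeff_eq_zero hi, Nat.cast_zero])

theorem newtonFun_eq_zero [Fintype σ] {a K : σ → ℕ} {P : MvPolynomial σ ℚ}
    (h : ∀ t ∈ P.support, ¬ ∀ i, a i ≤ t i) : newtonFun a K P = 0 := by
  rw [newtonFun, prodFun_eq_sum]
  exact Finset.sum_eq_zero fun t ht => by rw [prod_newtonCoeff_eq_zero (h t ht), smul_zero]

/-- Only monomials `t ≥ a` contribute. One of largest total degree among them is maximal in `P`,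
since any monomial above it is again above `a`; hence its coefficient is positive, and these top
terms determine the sign for large `K`. -/
theorem eventually_newtonFun_nonneg [Fintype σ] {P : MvPolynomial σ ℚ} (hP : MaximalNonneg P)
    (a : σ → ℕ) : ∀ᶠ K : ℕ in Filter.atTop, 0 ≤ newtonFun a (fun _ => K) P := by
  classical
  set U := P.support.filter fun t => ∀ i, a i ≤ t i with hU
  rcases U.eq_empty_or_nonempty with h | h
  · refine Filter.Eventually.of_forall fun K => (newtonFun_eq_zero fun t ht hta => ?_).ge
    have : t ∈ U := Finset.mem_filter.2 ⟨ht, hta⟩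
    simp [h] at this
  obtain ⟨t₀, ht₀, hmax⟩ := U.exists_max_image (fun t => ∑ i, t i) h
  set m := ∑ i, t₀ i with hm
  have hpos : ∀ t ∈ U, ∑ i, t i = m → 0 < P.coeff t := by
    intro t ht htm
    have htP := (Finset.mem_filter.1 ht).1
    refine lt_of_le_of_ne (hP t ⟨htP, fun u hu htu => ?_⟩)
      (Ne.symm (MvPolynomial.mem_support_iff.1 htP))
    have huU : u ∈ U := Finset.mem_filter.2
      ⟨hu, fun i => ((Finset.mem_filter.1 ht).2 i).trans (htu i)⟩
    have hle : ∑ i, u i ≤ ∑ i, t i := (hmax u huU).trans htm.ge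
    have heq := (Finset.sum_eq_sum_iff_of_le fun i _ => htu i).1
      (le_antisymm (Finset.sum_le_sum fun i _ => htu i) hle)
    exact fun i => (heq i (Finset.mem_univ i)).ge
  -- The difference is rescaled by `K ^ |a| / K ^ m`, where `m` is the largest total degree of a
  -- contributing monomial; in the limit exactly the terms of degree `m` survive.
  have hlim : Filter.Tendsto (fun K : ℕ => ∑ t ∈ P.support, ((P.coeff t : ℚ) : ℝ) *
      ((∏ i, ((K : ℝ) ^ a i * newtonCoeff K (t i) (a i)) / (K : ℝ) ^ t i) *
        ((K : ℝ) ^ (∑ i, t i) / (K : ℝ) ^ m))) Filter.atTop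
      (nhds (∑ t ∈ P.support, if t ∈ U ∧ ∑ i, t i = m then
        ((P.coeff t : ℚ) : ℝ) * ((∏ i, ((t i).descFactorial (a i) : ℝ)) * 1) else 0)) := by
    refine tendsto_finsetSum _ fun t ht => ?_
    by_cases htU : t ∈ U
    · have h1 : Filter.Tendsto (fun K : ℕ => ∏ i,
          ((K : ℝ) ^ a i * newtonCoeff K (t i) (a i)) / (K : ℝ) ^ t i) Filter.atTop
          (nhds (∏ i, ((t i).descFactorial (a i) : ℝ))) :=
        tendsto_finsetProd _ fun i _ => tendsto_newtonCoeff (t i) (a i)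
      by_cases htm : ∑ i, t i = m
      · rw [if_pos ⟨htU, htm⟩]
        refine (h1.mul ?_).const_mul _
        refine (Filter.tendsto_congr' ?_).1 tendsto_const_nhds
        filter_upwards [Filter.eventually_gt_atTop 0] with K hK
        have : (K : ℝ) ≠ 0 := by positivity
        rw [htm, div_self (pow_ne_zero _ this)]
      · rw [if_neg fun h => htm h.2]
        have hlt : ∑ i, t i < m := lt_of_le_of_ne (hmax t htU) htm
        have h2 : Filter.Tendsto (fun K : ℕ => (K : ℝ) ^ (∑ i, t i) / (K : ℝ) ^ m) Filter.atTop
            (nhds 0) :=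
          (tendsto_pow_div_pow_atTop_zero hlt).comp tendsto_natCast_atTop_atTop
        simpa using (h1.mul h2).const_mul ((P.coeff t : ℚ) : ℝ)
    · rw [if_neg fun h => htU h.1]
      have : ¬ ∀ i, a i ≤ t i := fun h => htU (Finset.mem_filter.2 ⟨ht, h⟩)
      push Not at this
      obtain ⟨i, hi⟩ := this
      refine (Filter.tendsto_congr fun K => ?_).1 tendsto_const_nhds
      rw [Finset.prod_eq_zero (Finset.mem_univ i)]
      · simp
      · simp [newtonCoeff_eq_zero hi]
  have hLpos : 0 < ∑ t ∈ P.support, if t ∈ U ∧ ∑ i, t i = m then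
        ((P.coeff t : ℚ) : ℝ) * ((∏ i, ((t i).descFactorial (a i) : ℝ)) * 1) else 0 := by
    have hterm : ∀ t, t ∈ U ∧ ∑ i, t i = m →
        0 < ((P.coeff t : ℚ) : ℝ) * ((∏ i, ((t i).descFactorial (a i) : ℝ)) * 1) := by
      rintro t ⟨htU, htm⟩
      refine mul_pos (by exact_mod_cast hpos t htU htm) ?_
      rw [mul_one]
      refine Finset.prod_pos fun i _ => ?_
      exact_mod_cast Nat.pos_of_ne_zero fun h0 =>
        absurd (Nat.descFactorial_eq_zero_iff_lt.1 h0) (not_lt.2 ((Finset.mem_filter.1 htU).2 i))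
    refine Finset.sum_pos' (fun t _ => ?_) ⟨t₀, (Finset.mem_filter.1 ht₀).1, ?_⟩
    · split_ifs with h
      · exact (hterm t h).le
      · exact le_rfl
    · rw [if_pos ⟨ht₀, rfl⟩]
      exact hterm t₀ ⟨ht₀, rfl⟩
  filter_upwards [hlim.eventually (lt_mem_nhds hLpos), Filter.eventually_gt_atTop 0] with K hK hK0
  have hK' : (0 : ℝ) < K := by exact_mod_cast hK0
  have key : ∑ t ∈ P.support, ((P.coeff t : ℚ) : ℝ) *
      ((∏ i, ((K : ℝ) ^ a i * newtonCoeff K (t i) (a i)) / (K : ℝ) ^ t i) *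
        ((K : ℝ) ^ (∑ i, t i) / (K : ℝ) ^ m)) =
      (newtonFun a (fun _ => K) P : ℝ) * ((K : ℝ) ^ (∑ i, a i) / (K : ℝ) ^ m) := by
    rw [newtonFun, prodFun_eq_sum]
    push_cast
    rw [Finset.sum_mul]
    refine Finset.sum_congr rfl fun t _ => ?_
    rw [Finset.prod_div_distrib, Finset.prod_mul_distrib, Finset.prod_pow_eq_pow_sum,
      Finset.prod_pow_eq_pow_sum]
    simp only [smul_eq_mul, Rat.cast_mul, Rat.cast_prod, Rat.cast_natCast]
    field_simp
  rw [key] at hK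
  have := pos_of_mul_pos_left hK (by positivity)
  exact_mod_cast this.le

/-- The threshold is uniform in `a` because differences of an order exceeding the total degree in
some coordinate vanish, which leaves finitely many `a`. -/
theorem exists_newtonFun_nonneg [Fintype σ] {P : MvPolynomial σ ℚ} (hP : MaximalNonneg P) :
    ∃ K₀ : ℕ, ∀ K ≥ K₀, ∀ a : σ → ℕ, 0 ≤ newtonFun a (fun _ => K) P := by
  classical
  have := (Filter.eventually_all_finset
    (Fintype.piFinset fun _ : σ => Finset.range (P.totalDegree + 1))).2
    fun a _ => eventually_newtonFun_nonneg hP a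
  obtain ⟨K₀, hK₀⟩ := Filter.eventually_atTop.1 this
  refine ⟨K₀, fun K hK a => ?_⟩
  by_cases ha : a ∈ Fintype.piFinset fun _ : σ => Finset.range (P.totalDegree + 1)
  · exact hK₀ K hK a ha
  · refine (newtonFun_eq_zero fun t ht h => ha (Fintype.mem_piFinset.2 fun i => ?_)).ge
    have h1 := MvPolynomial.le_totalDegree ht
    rw [Finsupp.sum_fintype _ _ fun _ => rfl] at h1
    have h2 := Finset.single_le_sum (f := fun i => t i) (fun _ _ => Nat.zero_le _)
      (Finset.mem_univ i)
    have := h i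
    simp only [Finset.mem_range]
    lia

theorem newtonFun_nonneg_of_le [Fintype σ] {P : MvPolynomial σ ℚ} {K₀ : ℕ}
    (h : ∀ a : σ → ℕ, 0 ≤ newtonFun a (fun _ => K₀) P) (a : σ → ℕ) {K : σ → ℕ}
    (hK : ∀ i, K₀ ≤ K i) : 0 ≤ newtonFun a K P := by
  classical
  rw [newtonFun, prodFun_expand (fun i => Finset.range (K i - K₀ + 1))
    (fun i j t => (newtonCoeff K₀ t (a i + j) : ℚ)) (fun i j => ((K i - K₀).choose j : ℚ))]
  · exact Finset.sum_nonneg fun b _ => mul_nonneg (h fun i => a i + b i)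
      (Finset.prod_nonneg fun i _ => Nat.cast_nonneg _)
  · intro t _ i
    conv_lhs => rw [← Nat.add_sub_cancel' (hK i), newtonCoeff_add_base]
    push_cast
    exact Finset.sum_congr rfl fun j _ => mul_comm _ _

theorem newtonFun_restrict [Fintype σ] (ν : σ → Option ℕ) (P : MvPolynomial σ ℚ) (a K : σ → ℕ)
    (h : ∀ i v, ν i = some v → a i = 0 ∧ K i = v) :
    newtonFun (fun i : {i // ν i = none} => a i) (fun i => K i) (restrict ν P) =
      newtonFun a K P := by
  rw [newtonFun, prodFun_restrict, newtonFun]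
  congr 1
  congr 1
  funext i t
  rcases hi : ν i with _ | v
  · rw [extendFun_none hi]
  · rw [extendFun_some hi, (h i v hi).1, (h i v hi).2, newtonCoeff_zero_right, Nat.cast_pow]

/-- Induction on the number of free indeterminates. If all free coordinates of `K` are large, the
threshold for `restrict ν P` applies. Otherwise some free `K i` is among finitely many small values
and `a i = 0`, so the difference is one of a polynomial in which `X_i` has also been replaced by `K
i`. -/
theorem exists_uniform_newtonFun_nonneg [Fintype σ] {P : MvPolynomial σ ℚ}
    (hP : StronglyNonneg P) :
    ∃ K₀ : ℕ, ∀ a K : σ → ℕ, (∀ i, K₀ ≤ K i ∨ a i = 0) → 0 ≤ newtonFun a K P := by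
  classical
  suffices H : ∀ (n : ℕ) (ν : σ → Option ℕ), (Finset.univ.filter fun i => ν i = none).card = n →
      ∃ K₀ : ℕ, ∀ a K : σ → ℕ, (∀ i v, ν i = some v → a i = 0 ∧ K i = v) →
        (∀ i, ν i = none → K₀ ≤ K i ∨ a i = 0) → 0 ≤ newtonFun a K P by
    obtain ⟨K₀, h⟩ := H _ (fun _ => none) rfl
    exact ⟨K₀, fun a K haK => h a K (fun i v hi => by simp at hi) fun i _ => haK i⟩
  intro n
  induction n using Nat.strong_induction_on with
  | _ n ih =>
    intro ν hν
    obtain ⟨K₁, hK₁⟩ := exists_newtonFun_nonneg (hP ν)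
    have hrec : ∀ (i : σ) (v : ℕ), ∃ K₀ : ℕ, ν i = none → ∀ a K : σ → ℕ,
        (∀ j w, Function.update ν i (some v) j = some w → a j = 0 ∧ K j = w) →
        (∀ j, Function.update ν i (some v) j = none → K₀ ≤ K j ∨ a j = 0) →
        0 ≤ newtonFun a K P := by
      intro i v
      by_cases hi : ν i = none
      · have hlt : (Finset.univ.filter fun j => Function.update ν i (some v) j = none).card < n := by
          rw [← hν]
          refine Finset.card_lt_card ⟨fun j hj => ?_, fun hsub => ?_⟩
          · simp only [Finset.mem_filter, Finset.mem_univ, true_and] at hj ⊢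
            by_cases hji : j = i
            · rw [hji, hi]
            · rwa [Function.update_of_ne hji] at hj
          · have := hsub (Finset.mem_filter.2 ⟨Finset.mem_univ i, hi⟩)
            simp at this
        obtain ⟨K₀, h⟩ := ih _ hlt _ rfl
        exact ⟨K₀, fun _ => h⟩
      · exact ⟨0, fun h => absurd h hi⟩
    choose K₂ hK₂ using hrec
    -- The threshold exceeds `K₁` and the inductive thresholds for all substitutions of a value `v <
    -- K₁` for one indeterminate.
    refine ⟨max K₁ (Finset.univ.sup fun i => (Finset.range K₁).sup fun v => K₂ i v),
      fun a K hfix hfree => ?_⟩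
    by_cases hall : ∀ i, ν i = none → K₁ ≤ K i
    · rw [← newtonFun_restrict ν P a K hfix]
      exact newtonFun_nonneg_of_le (hK₁ K₁ le_rfl) _ fun i => hall i i.2
    · push Not at hall
      obtain ⟨i, hi, hlt⟩ := hall
      have hai : a i = 0 := (hfree i hi).resolve_left
        (not_le.2 (lt_of_lt_of_le hlt (le_max_left _ _)))
      refine hK₂ i (K i) hi a K (fun j w hj => ?_) fun j hj => ?_
      · by_cases hji : j = i
        · subst hji
          rw [Function.update_self] at hj
          exact ⟨hai, Option.some_injective _ hj⟩
        · rw [Function.update_of_ne hji] at hj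
          exact hfix j w hj
      · have hji : j ≠ i := by
          rintro rfl
          simp at hj
        rw [Function.update_of_ne hji] at hj
        refine (hfree j hj).imp_left fun h => le_trans ?_ (le_trans (le_max_right _ _) h)
        exact le_trans (Finset.le_sup (f := fun v => K₂ i v) (Finset.mem_range.2 hlt))
          (Finset.le_sup (f := fun i => (Finset.range K₁).sup fun v => K₂ i v) (Finset.mem_univ i))

theorem newtonFun_sub [Fintype σ] [DecidableEq σ] (P : MvPolynomial σ ℚ) (a K : σ → ℕ) (i : σ) :
    newtonFun (Function.update a i (a i + 1)) K P =
      newtonFun a (Function.update K i (K i + 1)) P - newtonFun a K P := by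
  simp only [newtonFun, prodFun_eq_sum, ← Finset.sum_sub_distrib, ← smul_sub]
  refine Finset.sum_congr rfl fun t _ => ?_
  congr 1
  rw [← Finset.mul_prod_erase _ _ (Finset.mem_univ i), ← Finset.mul_prod_erase _ _ (Finset.mem_univ i),
    ← Finset.mul_prod_erase _ _ (Finset.mem_univ i)]
  have h1 : ∏ j ∈ Finset.univ.erase i,
      (newtonCoeff (K j) (t j) (Function.update a i (a i + 1) j) : ℚ) =
      ∏ j ∈ Finset.univ.erase i, (newtonCoeff (K j) (t j) (a j) : ℚ) :=
    Finset.prod_congr rfl fun j hj => by rw [Function.update_of_ne (Finset.ne_of_mem_erase hj)]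
  have h2 : ∏ j ∈ Finset.univ.erase i,
      (newtonCoeff (Function.update K i (K i + 1) j) (t j) (a j) : ℚ) =
      ∏ j ∈ Finset.univ.erase i, (newtonCoeff (K j) (t j) (a j) : ℚ) :=
    Finset.prod_congr rfl fun j hj => by rw [Function.update_of_ne (Finset.ne_of_mem_erase hj)]
  rw [h1, h2, Function.update_self, Function.update_self, newtonCoeff_succ_base, ← sub_mul]
  push_cast
  ring

theorem newtonFun_zero [Fintype σ] (P : MvPolynomial σ ℚ) (K : σ → ℕ) :
    newtonFun (fun _ => 0) K P = MvPolynomial.eval (fun i => (K i : ℚ)) P := by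
  rw [newtonFun, eval_eq_prodFun]
  simp only [newtonCoeff_zero_right, Nat.cast_pow]

/-- By induction on the total order, a difference is an integer combination of values at points of
`ℕ^σ`. -/
theorem exists_int_newtonFun [Fintype σ] {P : MvPolynomial σ ℚ}
    (h : ∀ x : σ → ℕ, ∃ m : ℤ, MvPolynomial.eval (fun i => (x i : ℚ)) P = m) (a K : σ → ℕ) :
    ∃ m : ℤ, newtonFun a K P = m := by
  classical
  induction hn : ∑ i, a i generalizing a K with
  | zero =>
    have : a = fun _ => 0 := funext fun i => by simpa using Finset.sum_eq_zero_iff.1 hn i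
    rw [this, newtonFun_zero]
    exact h K
  | succ n ih =>
    obtain ⟨i, hi⟩ : ∃ i, a i ≠ 0 := by
      by_contra! h0
      simp [h0] at hn
    obtain ⟨b, hb⟩ := Nat.exists_eq_succ_of_ne_zero hi
    have ha : a = Function.update (Function.update a i b) i (Function.update a i b i + 1) := by
      simpa using hb
    have hsum : ∑ j, Function.update a i b j = n := by
      rw [← Finset.add_sum_erase _ _ (Finset.mem_univ i), Function.update_self,
        Finset.sum_congr rfl fun j hj => Function.update_of_ne (Finset.ne_of_mem_erase hj) b a]
      rw [← Finset.add_sum_erase _ _ (Finset.mem_univ i)] at hn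
      lia
    rw [ha, newtonFun_sub]
    obtain ⟨m₁, h₁⟩ := ih (Function.update a i b) (Function.update K i (K i + 1)) hsum
    obtain ⟨m₂, h₂⟩ := ih (Function.update a i b) K hsum
    exact ⟨m₁ - m₂, by rw [h₁, h₂]; push_cast; rfl⟩

end Positivity

/-! ### Newton expansions and natural binomial polynomials -/

section Binomial

variable {σ : Type*}

theorem binomialMonomial_zero (i : σ) (l : ℕ) : binomialMonomial i l 0 = 1 := by
  simp [binomialMonomial]

theorem X_mul_binomialMonomial (i : σ) (l k : ℕ) :
    MvPolynomial.X i * binomialMonomial i l k =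
      ((k : ℚ) + 1) • binomialMonomial i l (k + 1) + ((l : ℚ) + k) • binomialMonomial i l k := by
  have h : (MvPolynomial.C (1 / (k.factorial : ℚ)) : MvPolynomial σ ℚ) =
      MvPolynomial.C ((k : ℚ) + 1) * MvPolynomial.C (1 / ((k + 1).factorial : ℚ)) := by
    rw [← map_mul, Nat.factorial_succ]
    congr 1
    have : (k.factorial : ℚ) ≠ 0 := by exact_mod_cast k.factorial_ne_zero
    push_cast
    field_simp
  simp only [binomialMonomial, Finset.prod_range_succ, MvPolynomial.smul_eq_C_mul]
  rw [← mul_assoc (MvPolynomial.C ((k : ℚ) + 1)), ← h]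
  ring

theorem X_pow_eq_sum_binomialMonomial (i : σ) (K t : ℕ) {m : ℕ} (hm : t < m) :
    (MvPolynomial.X i : MvPolynomial σ ℚ) ^ t =
      ∑ a ∈ Finset.range m, (newtonCoeff K t a : ℚ) • binomialMonomial i K a := by
  induction t generalizing m with
  | zero =>
    rw [Finset.sum_eq_single_of_mem 0 (Finset.mem_range.2 hm)]
    · simp [newtonCoeff, binomialMonomial_zero]
    · intro b _ hb
      rw [newtonCoeff_eq_zero (Nat.pos_of_ne_zero hb), Nat.cast_zero, zero_smul]
  | succ t ih =>
    obtain ⟨n, rfl⟩ := Nat.exists_eq_succ_of_ne_zero (by omega : m ≠ 0)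
    have e : ∑ a ∈ Finset.range n, (newtonCoeff K t a : ℚ) • (((K : ℚ) + a) • binomialMonomial i K a) =
        ∑ a ∈ Finset.range (n + 1),
          (newtonCoeff K t a : ℚ) • (((K : ℚ) + a) • binomialMonomial i K a) := by
      rw [Finset.sum_range_succ, newtonCoeff_eq_zero (by omega : t < n)]
      simp
    rw [pow_succ', ih (by omega : t < n), Finset.mul_sum]
    simp only [mul_smul_comm, X_mul_binomialMonomial, smul_add, Finset.sum_add_distrib]
    rw [e, Finset.sum_range_succ' _ n, Nat.succ_eq_add_one, Finset.sum_range_succ' _ n, ← add_assoc,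
      ← Finset.sum_add_distrib]
    congr 1
    · refine Finset.sum_congr rfl fun a _ => ?_
      rw [newtonCoeff, smul_smul, smul_smul, ← add_smul]
      congr 1
      push_cast
      ring
    · rw [newtonCoeff, smul_smul]
      congr 1
      push_cast
      ring

/-- The multivariate Newton expansion around `(K, …, K)`, as an identity of polynomials rather than
of functions. -/
theorem eq_sum_newtonFun_smul [Fintype σ] [DecidableEq σ] (P : MvPolynomial σ ℚ) (K : ℕ) {m : ℕ}
    (hm : ∀ t ∈ P.support, ∀ i, t i < m) :
    P = ∑ a ∈ Fintype.piFinset fun _ : σ => Finset.range m,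
      newtonFun a (fun _ => K) P • ∏ i, binomialMonomial i K (a i) := by
  conv_lhs => rw [eq_prodFun_X P]
  exact prodFun_expand (R := ℚ) (fun _ => Finset.range m)
    (fun _ j t => (newtonCoeff K t j : ℚ)) (fun i j => binomialMonomial i K j) _ P
    fun t ht i => X_pow_eq_sum_binomialMonomial i K (t i) (hm t ht i)

theorem apply_lt_totalDegree_succ [Fintype σ] {P : MvPolynomial σ ℚ} :
    ∀ t ∈ P.support, ∀ i, t i < P.totalDegree + 1 := by
  intro t ht i
  have h1 := MvPolynomial.le_totalDegree ht
  rw [Finsupp.sum_fintype _ _ fun _ => rfl] at h1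
  have h2 := Finset.single_le_sum (f := fun i => t i) (fun _ _ => Nat.zero_le _)
    (Finset.mem_univ i)
  lia

theorem exists_int_eval_binomialMonomial (i : σ) (l k : ℕ) (x : σ → ℤ) :
    ∃ m : ℤ, MvPolynomial.eval (fun i => (x i : ℚ)) (binomialMonomial i l k) = m := by
  -- `Ring.choose` is the binomial coefficient with an arbitrary integer on top, as `x i - l` may be
  -- negative.
  refine ⟨Ring.choose (x i - l) k, ?_⟩
  have h := Ring.descPochhammer_eq_factorial_smul_choose (x i - l) k
  have hk : (k.factorial : ℚ) ≠ 0 := by exact_mod_cast k.factorial_ne_zero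
  rw [← Polynomial.eval_eq_smeval, descPochhammer_eval_eq_prod_range, nsmul_eq_mul] at h
  have h' := congrArg (Int.cast : ℤ → ℚ) h
  push_cast at h'
  simp only [binomialMonomial, map_mul, MvPolynomial.eval_C, map_prod, map_sub, MvPolynomial.eval_X,
    one_div]
  rw [inv_mul_eq_iff_eq_mul₀ hk, ← h']
  exact Finset.prod_congr rfl fun t _ => by ring

theorem exists_int_eval_prod_binomialMonomial [Fintype σ] (l k : σ → ℕ) (x : σ → ℤ) :
    ∃ m : ℤ, MvPolynomial.eval (fun i => (x i : ℚ)) (∏ j, binomialMonomial j (l j) (k j)) = m := by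
  choose m hm using fun j => exists_int_eval_binomialMonomial j (l j) (k j) x
  exact ⟨∏ j, m j, by rw [map_prod, Finset.prod_congr rfl fun j _ => hm j]; push_cast; rfl⟩

/-- The coefficients of the Newton expansion at `0` only involve values on `ℕ^σ`, and binomial
polynomials are integral on all of `ℤ^σ`. -/
theorem IntegerValued.of_nat [Fintype σ] {P : MvPolynomial σ ℚ}
    (h : ∀ x : σ → ℕ, ∃ m : ℤ, MvPolynomial.eval (fun i => (x i : ℚ)) P = m) :
    IntegerValued P := by
  classical
  intro x
  choose d hd using fun a => exists_int_newtonFun h a (fun _ => 0)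
  choose b hb using fun a : σ → ℕ => exists_int_eval_prod_binomialMonomial (fun _ => 0) a x
  refine ⟨∑ a ∈ Fintype.piFinset fun _ : σ => Finset.range (P.totalDegree + 1), d a * b a, ?_⟩
  conv_lhs => rw [eq_sum_newtonFun_smul P 0 apply_lt_totalDegree_succ]
  rw [map_sum]
  push_cast
  exact Finset.sum_congr rfl fun a _ => by rw [MvPolynomial.smul_eval, hd, hb]

theorem IsNaturalBinomial.integerValued [Fintype σ] {P : MvPolynomial σ ℚ}
    (h : IsNaturalBinomial P) : IntegerValued P := by
  obtain ⟨n, c, p, κ, rfl⟩ := h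
  intro x
  choose b hb using fun r => exists_int_eval_prod_binomialMonomial (p r) (κ r) x
  refine ⟨∑ r, c r * b r, ?_⟩
  rw [map_sum]
  push_cast
  exact Finset.sum_congr rfl fun r _ => by rw [MvPolynomial.smul_eval, hb]

/-- A natural binomial polynomial with all shifts equal to `K`. -/
theorem isNaturalBinomial_of_newtonFun [Fintype σ] {P : MvPolynomial σ ℚ} {K : ℕ}
    (h : ∀ a : σ → ℕ, ∃ m : ℕ, newtonFun a (fun _ => K) P = m) : IsNaturalBinomial P := by
  classical
  choose d hd using h
  set B := Fintype.piFinset fun _ : σ => Finset.range (P.totalDegree + 1)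
  refine ⟨B.card, fun r => d (B.equivFin.symm r), fun _ _ => K, fun r => B.equivFin.symm r, ?_⟩
  conv_lhs => rw [eq_sum_newtonFun_smul P K apply_lt_totalDegree_succ]
  rw [← Finset.sum_coe_sort, ← B.equivFin.symm.sum_comp]
  exact Finset.sum_congr rfl fun r _ => by rw [hd]

theorem exists_binomialMonomial_eq_sum (i : σ) (p k : ℕ) :
    ∃ b : ℕ → ℚ, 0 < b k ∧
      binomialMonomial i p k = ∑ m ∈ Finset.range (k + 1), b m • MvPolynomial.X i ^ m := by
  -- Up to the factor `1 / k!`, the binomial monomial is a monic univariate polynomial of degree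
  -- `k`, whence the positive top coefficient.
  set g : Polynomial ℚ :=
    ∏ t ∈ Finset.range k, (Polynomial.X - Polynomial.C ((p : ℚ) + t)) with hg
  have hmonic : g.Monic := Polynomial.monic_prod_of_monic _ _ fun t _ => Polynomial.monic_X_sub_C _
  have hdeg : g.natDegree = k := by
    rw [hg, Polynomial.natDegree_prod_of_monic _ _ fun t _ => Polynomial.monic_X_sub_C _,
      Finset.sum_congr rfl fun t _ => Polynomial.natDegree_X_sub_C _]
    simp
  refine ⟨fun m => (1 / (k.factorial : ℚ)) * g.coeff m, ?_, ?_⟩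
  · have : g.coeff k = 1 := by rw [← hdeg]; exact hmonic
    simp only [this, mul_one]
    positivity
  · have h : Polynomial.aeval (MvPolynomial.X i : MvPolynomial σ ℚ) g =
        ∏ t ∈ Finset.range k, (MvPolynomial.X i - MvPolynomial.C ((p : ℚ) + t)) := by
      rw [hg, map_prod]
      exact Finset.prod_congr rfl fun t _ => by
        rw [map_sub, Polynomial.aeval_X, Polynomial.aeval_C, MvPolynomial.algebraMap_eq]
    rw [binomialMonomial, ← h, Polynomial.aeval_eq_sum_range, hdeg, Finset.mul_sum]
    exact Finset.sum_congr rfl fun m _ => by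
      rw [← MvPolynomial.smul_eq_C_mul, smul_smul]

/-- The monomial `t` occurs in `∏ (X_j - p_j choose κ_j)` only if `t ≤ κ`. -/
theorem coeff_prod_binomialMonomial [Fintype σ] (p κ : σ → ℕ) :
    (∀ t : σ →₀ ℕ, (∏ j, binomialMonomial j (p j) (κ j)).coeff t ≠ 0 → ∀ j, t j ≤ κ j) ∧
    0 < (∏ j, binomialMonomial j (p j) (κ j)).coeff (Finsupp.equivFunOnFinite.symm κ) := by
  classical
  choose b hb hsum using fun j => exists_binomialMonomial_eq_sum j (p j) (κ j)
  have hcoeff : ∀ t : σ →₀ ℕ, (∏ j, binomialMonomial j (p j) (κ j)).coeff t =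
      if ∀ j, t j ≤ κ j then ∏ j, b j (t j) else 0 := by
    intro t
    have hX : ∀ m : σ → ℕ, ∏ j, (MvPolynomial.X j : MvPolynomial σ ℚ) ^ m j =
        MvPolynomial.monomial (Finsupp.equivFunOnFinite.symm m) 1 := by
      intro m
      rw [MvPolynomial.monomial_eq, map_one, one_mul, Finsupp.prod_fintype _ _ fun i => pow_zero _]
      rfl
    rw [Finset.prod_congr rfl fun j _ => hsum j, Finset.prod_univ_sum, MvPolynomial.coeff_sum]
    simp only [Finset.prod_smul, hX, MvPolynomial.coeff_smul, MvPolynomial.coeff_monomial,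
      smul_eq_mul, mul_ite, mul_one, mul_zero, Equiv.symm_apply_eq]
    rw [Finset.sum_ite_eq' _ (Finsupp.equivFunOnFinite t) fun m => ∏ j, b j (m j)]
    simp [Fintype.mem_piFinset]
  refine ⟨fun t ht => ?_, ?_⟩
  · rw [hcoeff] at ht
    by_contra h
    exact ht (if_neg h)
  · have hle : ∀ j, (Finsupp.equivFunOnFinite.symm κ) j ≤ κ j := fun j => le_refl (κ j)
    rw [hcoeff, if_pos hle]
    exact Finset.prod_pos fun j _ => hb j

/-- Let `s` be a maximal monomial. Some product with nonzero coefficient has a degree vector above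
`s`; take one, `u`, with largest sum. Every other product contributing to the coefficient of `u` has
degree vector `u` as well, so nothing cancels and this coefficient is positive. Maximality of `s`
forces `s = u`. -/
theorem IsNaturalBinomial.maximalNonneg [Fintype σ] {P : MvPolynomial σ ℚ}
    (h : IsNaturalBinomial P) : MaximalNonneg P := by
  classical
  obtain ⟨n, c, p, κ, hP⟩ := h
  intro s hs
  have hcoeff : ∀ t, P.coeff t =
      ∑ r, (c r : ℚ) * (∏ j, binomialMonomial j (p r j) (κ r j)).coeff t := by
    intro t
    rw [hP, MvPolynomial.coeff_sum]
    simp [MvPolynomial.coeff_smul]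
  have hterm : ∀ u : σ →₀ ℕ, (∀ r, c r ≠ 0 → (∀ j, u j ≤ κ r j) → κ r = u) →
      ∀ r, 0 ≤ (c r : ℚ) * (∏ j, binomialMonomial j (p r j) (κ r j)).coeff u := by
    intro u hu r
    by_cases hc : c r = 0
    · simp [hc]
    by_cases h0 : (∏ j, binomialMonomial j (p r j) (κ r j)).coeff u = 0
    · simp [h0]
    have hr := hu r hc ((coeff_prod_binomialMonomial (p r) (κ r)).1 u h0)
    have := (coeff_prod_binomialMonomial (p r) (κ r)).2
    have hu' : Finsupp.equivFunOnFinite.symm (κ r) = u := by ext j; simp [hr]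
    rw [hu'] at this
    exact mul_nonneg (Nat.cast_nonneg _) this.le
  set T := Finset.univ.filter fun r => c r ≠ 0 ∧ ∀ j, s j ≤ κ r j with hT
  have hTne : T.Nonempty := by
    by_contra hempty
    refine MvPolynomial.mem_support_iff.1 hs.1 ?_
    rw [hcoeff]
    refine Finset.sum_eq_zero fun r _ => ?_
    by_contra hne
    refine hempty ⟨r, Finset.mem_filter.2 ⟨Finset.mem_univ r, ?_, ?_⟩⟩
    · rintro h0
      simp [h0] at hne
    · exact (coeff_prod_binomialMonomial (p r) (κ r)).1 s (right_ne_zero_of_mul hne)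
  obtain ⟨r, hr, hmax⟩ := T.exists_max_image (fun r => ∑ j, κ r j) hTne
  obtain ⟨-, hcr, hsr⟩ := Finset.mem_filter.1 hr
  set u : σ →₀ ℕ := Finsupp.equivFunOnFinite.symm (κ r) with hu
  have huκ : ∀ r', c r' ≠ 0 → (∀ j, u j ≤ κ r' j) → κ r' = u := by
    intro r' hc hle
    have hr' : r' ∈ T := Finset.mem_filter.2
      ⟨Finset.mem_univ r', hc, fun j => (hsr j).trans (hle j)⟩
    have heq := (Finset.sum_eq_sum_iff_of_le fun j _ => hle j).1
      (le_antisymm (Finset.sum_le_sum fun j _ => hle j) (hmax r' hr'))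
    exact funext fun j => (heq j (Finset.mem_univ j)).symm
  have hpos : 0 < P.coeff u := by
    rw [hcoeff]
    refine Finset.sum_pos' (fun r' _ => hterm u huκ r') ⟨r, Finset.mem_univ r, ?_⟩
    exact mul_pos (by exact_mod_cast Nat.pos_of_ne_zero hcr)
      (coeff_prod_binomialMonomial (p r) (κ r)).2
  have hus : u ≤ s := hs.2 (MvPolynomial.mem_support_iff.2 hpos.ne') fun j => hsr j
  have : s = u := le_antisymm (fun j => hsr j) hus
  rw [this]
  exact hpos.le

theorem eval_restrict [Fintype σ] (ν : σ → Option ℕ) (P : MvPolynomial σ ℚ)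
    (x : {i // ν i = none} → ℚ) :
    MvPolynomial.eval x (restrict ν P) =
      MvPolynomial.eval (fun i => match h : ν i with
        | some n => (n : ℚ)
        | none => x ⟨i, h⟩) P := by
  rw [eval_eq_prodFun, prodFun_restrict, eval_eq_prodFun]
  congr 1
  congr 1
  funext i t
  obtain hi | ⟨v, hi⟩ := Option.eq_none_or_eq_some (ν i)
  · rw [extendFun_none hi]
    split <;> simp_all
  · rw [extendFun_some hi]
    split <;> simp_all

theorem IsStronglyNaturalBinomial.stronglyNonneg [Fintype σ] {P : MvPolynomial σ ℚ}
    (h : IsStronglyNaturalBinomial P) : StronglyNonneg P :=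
  fun ν => (h ν).maximalNonneg

theorem IsStronglyNaturalBinomial.integerValued [Fintype σ] {P : MvPolynomial σ ℚ}
    (h : IsStronglyNaturalBinomial P) : IntegerValued P := by
  intro x
  obtain ⟨m, hm⟩ := (h fun _ => none).integerValued fun i => x i
  refine ⟨m, ?_⟩
  rw [← hm, eval_restrict]

/-- Each restriction is expanded around its own threshold, beyond which its differences are
non-negative; they are integers since the restriction is integral at natural points. -/
theorem isStronglyNaturalBinomial_of_stronglyNonneg [Fintype σ] {P : MvPolynomial σ ℚ}
    (h : StronglyNonneg P) (hP : IntegerValued P) : IsStronglyNaturalBinomial P := by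
  intro ν
  obtain ⟨K₀, hK₀⟩ := exists_newtonFun_nonneg (h ν)
  refine isNaturalBinomial_of_newtonFun (K := K₀) fun a => ?_
  obtain ⟨m, hm⟩ := exists_int_newtonFun (P := restrict ν P) (fun x => by
    obtain ⟨m, hm⟩ := hP fun i => match h : ν i with
      | some n => (n : ℤ)
      | none => x ⟨i, h⟩
    refine ⟨m, ?_⟩
    rw [← hm, eval_restrict]
    congr 2
    funext i
    split <;> simp_all) a (fun _ => K₀)
  have h0 := hK₀ K₀ le_rfl a
  rw [hm] at h0
  refine ⟨m.toNat, ?_⟩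
  rw [hm]
  exact_mod_cast (Int.toNat_of_nonneg (by exact_mod_cast h0)).symm

theorem isMaximalMonomial_iff_of_coeff_ne_zero {R S : Type*} [CommSemiring R] [CommSemiring S]
    {P : MvPolynomial σ R} {Q : MvPolynomial σ S} (h : ∀ t, P.coeff t ≠ 0 ↔ Q.coeff t ≠ 0)
    (s : σ →₀ ℕ) : IsMaximalMonomial P s ↔ IsMaximalMonomial Q s := by
  have : P.support = Q.support := by
    ext t
    rw [MvPolynomial.mem_support_iff, MvPolynomial.mem_support_iff, h]
  rw [IsMaximalMonomial, IsMaximalMonomial, this]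

theorem map_restrict {R S : Type*} [CommSemiring R] [CommSemiring S] (f : R →+* S)
    (ν : σ → Option ℕ) (P : MvPolynomial σ R) :
    MvPolynomial.map f (restrict ν P) = restrict ν (MvPolynomial.map f P) := by
  rw [restrict, restrict, MvPolynomial.map_bind₁]
  congr 2
  funext i
  split <;> simp

/-- Scaling by a positive number preserves supports and signs, so the denominator plays no role; the
rest of the argument works over `ℚ` with `StronglyNonneg`. -/
theorem polyStrNNeg_iff {Q : MvPolynomial σ ℤ} {P : MvPolynomial σ ℚ} {a : ℚ} (ha : 0 < a)
    (h : MvPolynomial.map (Int.castRingHom ℚ) Q = a • P) : PolyStrNNeg Q ↔ StronglyNonneg P := by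
  have hcoeff : ∀ ν t, (((restrict ν Q).coeff t : ℤ) : ℚ) = a * (restrict ν P).coeff t := by
    intro ν t
    have h1 := congrArg (MvPolynomial.coeff t) (map_restrict (Int.castRingHom ℚ) ν Q)
    rw [MvPolynomial.coeff_map, h] at h1
    rw [← smul_eq_mul, ← MvPolynomial.coeff_smul]
    simpa [restrict] using h1
  have hmax : ∀ ν s, IsMaximalMonomial (restrict ν Q) s ↔ IsMaximalMonomial (restrict ν P) s :=
    fun ν => isMaximalMonomial_iff_of_coeff_ne_zero fun t => by
      rw [← Int.cast_ne_zero (α := ℚ), hcoeff, mul_ne_zero_iff]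
      exact ⟨fun h => h.2, fun h => ⟨ha.ne', h⟩⟩
  refine forall_congr' fun ν => forall_congr' fun s => ?_
  rw [hmax, ← Int.cast_nonneg_iff (R := ℚ), hcoeff, mul_nonneg_iff_of_pos_left ha]

theorem scaledPolyStrNNeg_iff (P : MvPolynomial σ ℚ) :
    ScaledPolyStrNNeg P ↔ StronglyNonneg P := by
  obtain ⟨hpos, Q, hQ⟩ := (leastDenominator_isLeast P).1
  have ha : (0 : ℚ) < leastDenominator P := by exact_mod_cast hpos
  exact ⟨fun ⟨Q', hQ', h⟩ => (polyStrNNeg_iff ha hQ').1 h,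
    fun h => ⟨Q, hQ, (polyStrNNeg_iff ha hQ).2 h⟩⟩

end Binomial

/-! ### Weighted automata as products of matrices -/

section Value

open Matrix

variable {S A : Type} [CommSemiring S]

/-- The transition matrix of a letter. -/
def WeightedAutomaton.mat (𝒜 : WeightedAutomaton S A) (a : A) :
    Matrix 𝒜.State 𝒜.State S := Matrix.of fun q q' => 𝒜.trans q a q'

theorem WeightedAutomaton.value_nil (𝒜 : WeightedAutomaton S A) :
    𝒜.value [] = 𝒜.init ⬝ᵥ 𝒜.final := by
  rw [WeightedAutomaton.value, dotProduct, ← (Equiv.funUnique (Fin 1) 𝒜.State).sum_comp]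
  simp

theorem WeightedAutomaton.value_cons (𝒜 : WeightedAutomaton S A) (a : A) (w : List A) :
    𝒜.value (a :: w) = WeightedAutomaton.value
      { 𝒜 with init := 𝒜.init ᵥ* 𝒜.mat a } w := by
  rw [WeightedAutomaton.value, WeightedAutomaton.value]
  change ∑ ρ : Fin (w.length + 1 + 1) → 𝒜.State, _ = _
  rw [← (Fin.consEquiv fun _ => 𝒜.State).sum_comp, Fintype.sum_prod_type, Finset.sum_comm]
  refine Finset.sum_congr rfl fun ρ _ => ?_
  simp only [vecMul, dotProduct, Finset.sum_mul]
  refine Finset.sum_congr rfl fun q _ => ?_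
  change 𝒜.init q * (∏ i : Fin (w.length + 1), _) * 𝒜.final (ρ (Fin.last w.length)) = _
  rw [Fin.prod_univ_succ]
  change 𝒜.init q * (𝒜.trans q a (ρ 0) * (∏ i : Fin w.length,
    𝒜.trans (ρ i.castSucc) (w.get i) (ρ i.succ))) * 𝒜.final (ρ (Fin.last w.length)) =
      𝒜.init q * 𝒜.trans q a (ρ 0) * _ * _
  ring

theorem WeightedAutomaton.value_eq (𝒜 : WeightedAutomaton S A) [DecidableEq 𝒜.State]
    (w : List A) : 𝒜.value w = 𝒜.init ⬝ᵥ ((w.map 𝒜.mat).prod *ᵥ 𝒜.final) := by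
  suffices H : ∀ v : 𝒜.State → S, WeightedAutomaton.value { 𝒜 with init := v } w =
      v ⬝ᵥ ((w.map 𝒜.mat).prod *ᵥ 𝒜.final) from H 𝒜.init
  induction w with
  | nil => intro v; rw [value_nil]; simp
  | cons a w ih =>
    intro v
    rw [value_cons]
    refine (ih _).trans ?_
    rw [List.map_cons, List.prod_cons, ← mulVec_mulVec, dotProduct_mulVec v]
    rfl

end Value

/-! ### Differences of powers of non-negative matrices -/

section NonnegMatrix

variable {n : Type*}

theorem mul_apply_nonneg [Fintype n] {A B : Matrix n n ℤ} (hA : ∀ p q, 0 ≤ A p q) (hB : ∀ p q, 0 ≤ B p q) :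
    ∀ p q, 0 ≤ (A * B) p q := fun p q => by
  rw [Matrix.mul_apply]
  exact Finset.sum_nonneg fun r _ => mul_nonneg (hA p r) (hB r q)

theorem one_apply_nonneg [DecidableEq n] : ∀ p q, 0 ≤ (1 : Matrix n n ℤ) p q := fun p q => by
  rw [Matrix.one_apply]
  split_ifs <;> simp

theorem list_prod_apply_nonneg [Fintype n] [DecidableEq n] {l : List (Matrix n n ℤ)} (h : ∀ A ∈ l, ∀ p q, 0 ≤ A p q) :
    ∀ p q, 0 ≤ l.prod p q := by
  induction l with
  | nil => exact one_apply_nonneg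
  | cons A l ih =>
    rw [List.prod_cons]
    exact mul_apply_nonneg (h A (by simp)) (ih fun B hB => h B (by simp [hB]))

theorem pow_apply_nonneg [Fintype n] [DecidableEq n] {A : Matrix n n ℤ} (hA : ∀ p q, 0 ≤ A p q) (m : ℕ) :
    ∀ p q, 0 ≤ (A ^ m) p q := by
  rw [← List.prod_replicate]
  exact list_prod_apply_nonneg fun B hB => by rw [List.eq_of_mem_replicate hB]; exact hA

theorem mul_apply_pos [Fintype n] {A B : Matrix n n ℤ} (hA : ∀ p q, 0 ≤ A p q) (hB : ∀ p q, 0 ≤ B p q)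
    {p q r : n} (h₁ : 0 < A p q) (h₂ : 0 < B q r) : 0 < (A * B) p r := by
  rw [Matrix.mul_apply]
  exact Finset.sum_pos' (fun s _ => mul_nonneg (hA p s) (hB s r))
    ⟨q, Finset.mem_univ q, mul_pos h₁ h₂⟩

theorem pow_apply_self_pos [Fintype n] [DecidableEq n] {A : Matrix n n ℤ} (hA : ∀ p q, 0 ≤ A p q) {p : n} (h : 0 < A p p)
    (m : ℕ) : 0 < (A ^ m) p p := by
  induction m with
  | zero => simp
  | succ m ih => rw [pow_succ]; exact mul_apply_pos (pow_apply_nonneg hA m) hA ih h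

/-- The differences of all orders, for a suitable step `N`, of the powers of a non-negative
matrix are eventually non-negative. -/
theorem exists_pow_mul_sub_pow_nonneg [Fintype n] [DecidableEq n] {A : Matrix n n ℤ} (hA : ∀ p q, 0 ≤ A p q) :
    ∃ N : ℕ, 0 < N ∧ ∀ s : ℕ, ∃ T : ℕ, ∀ x ≥ T, ∀ p q, 0 ≤ (A ^ x * (A ^ N - 1) ^ s) p q := by
  classical
  -- The states lying on a closed path of the graph of `A`. The step `N` will be a common multiple
  -- of return times, so that `(A ^ N) p p ≥ 1` and row `p` of `A ^ N - 1` is non-negative for each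
  -- such `p`.
  set cyc : n → Prop := fun p => ∃ m, 0 < m ∧ 0 < (A ^ m) p p with hcyc
  have hper : ∀ p, ∃ m, 0 < m ∧ (cyc p → 0 < (A ^ m) p p) := by
    intro p
    by_cases h : cyc p
    · obtain ⟨m, hm, hp⟩ := h
      exact ⟨m, hm, fun _ => hp⟩
    · exact ⟨1, one_pos, fun h' => absurd h' h⟩
  choose m hm hmp using hper
  refine ⟨∏ p, m p, Finset.prod_pos fun p _ => hm p, ?_⟩
  set N := ∏ p, m p
  have hB : ∀ p, cyc p → ∀ q, 0 ≤ (A ^ N - 1) p q := by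
    intro p hp q
    rw [Matrix.sub_apply, Matrix.one_apply]
    split_ifs with h
    · subst h
      obtain ⟨k, hk⟩ := Finset.dvd_prod_of_mem m (Finset.mem_univ p)
      have : 0 < (A ^ N) p p := by
        rw [show N = m p * k from hk, pow_mul]
        exact pow_apply_self_pos (pow_apply_nonneg hA _) (hmp p hp) k
      lia
    · simpa using pow_apply_nonneg hA N p q
  -- `q` is a successor of a state `p` on no closed path. A path starting at such a state never
  -- returns to it, so this relation is well-founded on the finite set of states.
  set r : n → n → Prop := fun q p => 0 < A p q ∧ ¬ cyc p with hr
  have hwf : WellFounded r := by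
    have htrans : ∀ q p, Relation.TransGen r q p → (∃ k, 0 < k ∧ 0 < (A ^ k) p q) ∧ ¬ cyc p := by
      intro q p h
      induction h with
      | single h => exact ⟨⟨1, one_pos, by simpa using h.1⟩, h.2⟩
      | tail _ h ih =>
        obtain ⟨⟨k, -, hpos⟩, -⟩ := ih
        refine ⟨⟨k + 1, Nat.succ_pos k, ?_⟩, h.2⟩
        rw [pow_succ']
        exact mul_apply_pos hA (pow_apply_nonneg hA k) h.1 hpos
    have : Std.Irrefl (Relation.TransGen r) := ⟨fun p h => (htrans p p h).2 (htrans p p h).1⟩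
    exact Subrelation.wf (fun {a b} h => Relation.TransGen.single h)
      (Finite.wellFounded_of_trans_of_irrefl (Relation.TransGen r))
  intro s
  suffices H : ∀ p, ∃ T : ℕ, ∀ x ≥ T, ∀ q, 0 ≤ (A ^ x * (A ^ N - 1) ^ s) p q by
    choose T hT using H
    exact ⟨Finset.univ.sup T, fun x hx p q =>
      hT p x ((Finset.le_sup (Finset.mem_univ p)).trans hx) q⟩
  induction s with
  | zero => exact fun p => ⟨0, fun x _ q => by simpa using pow_apply_nonneg hA x p q⟩
  | succ s ih =>
    choose T hT using ih
    intro p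
    induction p using hwf.induction with
    | _ p ihp =>
      by_cases hp : cyc p
      -- For `p` on a closed path, one factor `A ^ N - 1` is moved to the left: its row `p` is
      -- non-negative, and the rest is non-negative by induction on `s`.
      · refine ⟨Finset.univ.sup T, fun x hx q => ?_⟩
        have hcomm : A ^ x * (A ^ N - 1) ^ (s + 1) =
            (A ^ N - 1) * (A ^ x * (A ^ N - 1) ^ s) := by
          have : Commute (A ^ x) (A ^ N - 1) :=
            ((Commute.refl A).pow_pow x N).sub_right (Commute.one_right _)
          rw [pow_succ', ← mul_assoc, this.eq, mul_assoc]
        rw [hcomm, Matrix.mul_apply]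
        exact Finset.sum_nonneg fun q' _ => mul_nonneg (hB p hp q')
          (hT q' x ((Finset.le_sup (Finset.mem_univ q')).trans hx) q)
      -- For the other `p`, one factor `A` is split off on the left, which passes to the successors
      -- of `p` and costs one unit in the threshold.
      · have ihp' : ∀ q', ∃ T' : ℕ, 0 < A p q' → ∀ x ≥ T', ∀ q,
            0 ≤ (A ^ x * (A ^ N - 1) ^ (s + 1)) q' q := by
          intro q'
          by_cases hq' : 0 < A p q'
          · obtain ⟨T', h⟩ := ihp q' ⟨hq', hp⟩
            exact ⟨T', fun _ => h⟩
          · exact ⟨0, fun h => absurd h hq'⟩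
        choose T' hT' using ihp'
        refine ⟨Finset.univ.sup T' + 1, fun x hx q => ?_⟩
        obtain ⟨y, rfl⟩ := Nat.exists_eq_add_of_le' (le_of_add_le_right hx)
        rw [pow_succ', mul_assoc, Matrix.mul_apply]
        refine Finset.sum_nonneg fun q' _ => ?_
        rcases (hA p q').eq_or_lt with h | h
        · rw [← h, zero_mul]
        · exact mul_nonneg h.le (hT' q' h y
            ((Finset.le_sup (Finset.mem_univ q')).trans (Nat.le_of_succ_le_succ hx)) q)

end NonnegMatrix

/-! ### Necessity of the condition: rational series -/

/-- A difference with step `N` at `x` becomes one with step `1` at `x / N` after rescaling the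
variable, so the standard facts on `fwdDiff` of powers apply. -/
theorem sum_alternating_choose_mul_pow (s t : ℕ) (x N : ℚ) (hN : N ≠ 0) :
    ∑ j ∈ Finset.range (s + 1), ((-1) ^ (s - j) * (s.choose j : ℚ)) * (x + N * j) ^ t =
      N ^ t * (fwdDiff (1 : ℚ))^[s] (fun r : ℚ => r ^ t) (x / N) := by
  rw [fwdDiff_iter_eq_sum_shift, Finset.mul_sum]
  refine Finset.sum_congr rfl fun j _ => ?_
  have : (x + N * j) ^ t = N ^ t * (x / N + j) ^ t := by
    rw [← mul_pow]
    congr 1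
    field_simp
  rw [this, zsmul_eq_mul]
  push_cast
  simp only [nsmul_eq_mul, mul_one]
  ring

theorem pow_mul_sub_one_pow {R : Type*} [Ring R] (a : R) (x N s : ℕ) :
    a ^ x * (a ^ N - 1) ^ s =
      ∑ j ∈ Finset.range (s + 1), ((-1) ^ (s - j) * (s.choose j : ℤ)) • a ^ (x + N * j) := by
  rw [sub_eq_add_neg, (Commute.neg_one_right (a ^ N)).add_pow, Finset.mul_sum]
  refine Finset.sum_congr rfl fun j _ => ?_
  rw [zsmul_eq_mul, pow_add, pow_mul]
  push_cast
  have h1 : Commute ((-1 : R) ^ (s - j)) ((a ^ N) ^ j) := (Commute.neg_one_left _).pow_left _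
  have h2 : Commute ((s.choose j : R)) (a ^ x * (a ^ N) ^ j) := Nat.cast_commute _ _
  have h3 : Commute ((-1 : R) ^ (s - j)) (a ^ x) := (Commute.neg_one_left _).pow_left _
  rw [← mul_assoc (a ^ x), ← mul_assoc (a ^ x), ← (h3.mul_right h1).eq, mul_assoc, mul_assoc _ (s.choose j : R), h2.eq]

theorem prod_map_dagger {M : Type*} [Monoid M] {B : Type} {k : ℕ} (f : B → M) (η : Fin k → B)
    (x : Fin k → ℕ) :
    ((dagger η x).map f).prod = (List.ofFn fun i => f (η i) ^ x i).prod := by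
  rw [dagger, List.map_flatten, List.prod_flatten, List.map_map, List.map_ofFn]
  congr 2
  funext i
  simp

/-- Mixed differences of a rational series along powers of letters are eventually
non-negative. -/
theorem WeightedAutomaton.exists_sum_value_nonneg {B : Type} (𝒜 : WeightedAutomaton ℕ B) {k : ℕ}
    (η : Fin k → B) (s : Fin k → ℕ) :
    ∃ N T : Fin k → ℕ, (∀ i, 0 < N i) ∧ ∀ x : Fin k → ℕ, (∀ i, T i ≤ x i ∨ s i = 0) →
      0 ≤ ∑ j ∈ Fintype.piFinset fun i => Finset.range (s i + 1),
        (∏ i, ((-1) ^ (s i - j i) * ((s i).choose (j i) : ℤ))) *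
          (𝒜.value (dagger η fun i => x i + N i * j i) : ℤ) := by
  classical
  set A : Fin k → Matrix 𝒜.State 𝒜.State ℤ := fun i =>
    (𝒜.mat (η i)).map (Nat.castRingHom ℤ) with hA
  have hApos : ∀ i p q, 0 ≤ A i p q := fun i p q => by simp [hA]
  choose N hN hT using fun i => exists_pow_mul_sub_pow_nonneg (hApos i)
  choose T hT using hT
  refine ⟨N, fun i => T i (s i), hN, fun x hx => ?_⟩
  have hval : ∀ y : Fin k → ℕ, (𝒜.value (dagger η y) : ℤ) =
      (fun q => (𝒜.init q : ℤ)) ⬝ᵥ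
        ((List.ofFn fun i => A i ^ y i).prod.mulVec fun q => (𝒜.final q : ℤ)) := by
    intro y
    rw [𝒜.value_eq, prod_map_dagger]
    have h : ((List.ofFn fun i => 𝒜.mat (η i) ^ y i).prod).map (Nat.castRingHom ℤ) =
        (List.ofFn fun i => A i ^ y i).prod := by
      change (Nat.castRingHom ℤ).mapMatrix _ = _
      rw [map_list_prod, List.map_ofFn]
      congr 2
      funext i
      rw [Function.comp_apply, map_pow]
      rfl
    rw [← h]
    simp [dotProduct, Matrix.mulVec]
  have hsum : ∑ j ∈ Fintype.piFinset fun i => Finset.range (s i + 1),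
        (∏ i, ((-1) ^ (s i - j i) * ((s i).choose (j i) : ℤ))) •
          (List.ofFn fun i => A i ^ (x i + N i * j i)).prod =
      (List.ofFn fun i => A i ^ x i * (A i ^ N i - 1) ^ s i).prod := by
    simp only [pow_mul_sub_one_pow]
    -- The matrices of distinct letters need not commute; multilinearity of the ordered product
    -- expands all sums at once.
    have := MultilinearMap.map_sum_finset
      (MultilinearMap.mkPiAlgebraFin ℤ k (Matrix 𝒜.State 𝒜.State ℤ))
      (fun i j => ((-1) ^ (s i - j) * ((s i).choose j : ℤ)) • A i ^ (x i + N i * j))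
      (fun i => Finset.range (s i + 1))
    rw [MultilinearMap.mkPiAlgebraFin_apply] at this
    rw [this]
    refine Finset.sum_congr rfl fun j _ => ?_
    rw [MultilinearMap.map_smul_univ, MultilinearMap.mkPiAlgebraFin_apply]
  have hfinal : ∑ j ∈ Fintype.piFinset fun i => Finset.range (s i + 1),
        (∏ i, ((-1) ^ (s i - j i) * ((s i).choose (j i) : ℤ))) *
          (𝒜.value (dagger η fun i => x i + N i * j i) : ℤ) =
      (fun q => (𝒜.init q : ℤ)) ⬝ᵥ
        ((List.ofFn fun i => A i ^ x i * (A i ^ N i - 1) ^ s i).prod.mulVec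
          fun q => (𝒜.final q : ℤ)) := by
    rw [← hsum, Matrix.sum_mulVec, dotProduct_sum]
    refine Finset.sum_congr rfl fun j _ => ?_
    rw [hval, Matrix.smul_mulVec, dotProduct_smul, smul_eq_mul]
  rw [hfinal]
  have hnn : ∀ p q, 0 ≤ (List.ofFn fun i => A i ^ x i * (A i ^ N i - 1) ^ s i).prod p q := by
    refine list_prod_apply_nonneg fun M hM => ?_
    obtain ⟨i, rfl⟩ := List.mem_ofFn.1 hM
    rcases hx i with h | h
    · exact hT i (s i) (x i) h
    · rw [h, pow_zero, mul_one]
      exact pow_apply_nonneg (hApos i) _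
  exact Finset.sum_nonneg fun p _ => mul_nonneg (Nat.cast_nonneg _)
    (Finset.sum_nonneg fun q _ => mul_nonneg (hnn p q) (Nat.cast_nonneg _))

/-- Take the mixed difference of order `s` in the free variables, for a maximal monomial `s` of a
restriction. Any other monomial `t` has `t i < s i` for some `i` and is killed; on `s` itself the
difference is a product of numbers `N ^ s * s! > 0`. Since the mixed difference is non-negative, so
is the coefficient. -/
theorem stronglyNonneg_of_isRepresentedIn {k : ℕ} {P : MvPolynomial (Fin k) ℚ}
    (h : IsRepresentedIn IsNRational P) : StronglyNonneg P := by
  classical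
  obtain ⟨B, -, g, ⟨𝒜, hg⟩, -, η, hη⟩ := h
  intro ν s hs
  set s' : Fin k → ℕ := fun i => if h : ν i = none then s ⟨i, h⟩ else 0 with hs'
  obtain ⟨N, T, hN, hT⟩ := 𝒜.exists_sum_value_nonneg η s'
  -- Variables in the domain of `ν` keep their prescribed value and get order `0` in `s'`, hence
  -- need not be large; the others start at the threshold.
  set x : Fin k → ℕ := fun i => (ν i).getD (T i) with hx
  have hN' : ∀ i, (N i : ℚ) ≠ 0 := fun i => by exact_mod_cast (hN i).ne'
  have h0 := hT x fun i => by
    obtain hi | ⟨v, hi⟩ := Option.eq_none_or_eq_some (ν i)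
    · simp [hx, hi]
    · simp [hs', hi]
  have h1 : (0 : ℚ) ≤ prodFun (fun i t => ∑ j ∈ Finset.range (s' i + 1),
      ((-1) ^ (s' i - j) * ((s' i).choose j : ℚ)) * ((x i : ℚ) + N i * j) ^ t) P := by
    have h2 := prodFun_expand (fun i => Finset.range (s' i + 1))
      (fun i j t => ((x i : ℚ) + N i * j) ^ t)
      (fun i j => ((-1) ^ (s' i - j) * ((s' i).choose j : ℚ)))
      (fun i t => ∑ j ∈ Finset.range (s' i + 1),
      ((-1) ^ (s' i - j) * ((s' i).choose j : ℚ)) * ((x i : ℚ) + N i * j) ^ t) P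
      fun t _ i => Finset.sum_congr rfl fun j _ => mul_comm _ _
    rw [h2]
    have h3 : (0 : ℚ) ≤ ((∑ j ∈ Fintype.piFinset fun i => Finset.range (s' i + 1),
        (∏ i, ((-1) ^ (s' i - j i) * ((s' i).choose (j i) : ℤ))) *
          (𝒜.value (dagger η fun i => x i + N i * j i) : ℤ) : ℤ) : ℚ) := by exact_mod_cast h0
    refine h3.trans_eq ?_
    push_cast
    refine Finset.sum_congr rfl fun j _ => ?_
    have h4 := hη fun i => x i + N i * j i
    simp only [hg] at h4
    rw [h4, eval_eq_prodFun, mul_comm, smul_eq_mul]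
    push_cast
    rfl
  have h2 : prodFun (fun i t => ∑ j ∈ Finset.range (s' i + 1),
      ((-1) ^ (s' i - j) * ((s' i).choose j : ℚ)) * ((x i : ℚ) + N i * j) ^ t) P =
      prodFun (fun (i : {i // ν i = none}) t => (N i : ℚ) ^ t *
        (fwdDiff (1 : ℚ))^[s i] (fun r : ℚ => r ^ t) ((x i : ℚ) / N i)) (restrict ν P) := by
    rw [prodFun_restrict]
    congr 1
    congr 1
    funext i t
    obtain hi | ⟨v, hi⟩ := Option.eq_none_or_eq_some (ν i)
    · rw [extendFun_none hi, sum_alternating_choose_mul_pow _ _ _ _ (hN' i)]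
      simp [hs', hi]
    · rw [extendFun_some hi]
      simp [hs', hx, hi]
  rw [h2, prodFun_eq_sum, Finset.sum_eq_single_of_mem s hs.1] at h1
  · refine nonneg_of_mul_nonneg_left h1 (Finset.prod_pos fun i _ => ?_)
    rw [fwdDiff_iter_eq_factorial]
    have := hN i
    simp only [Pi.natCast_apply]
    positivity
  · intro t ht hts
    have : ¬ ∀ i, s i ≤ t i := fun hle => hts (le_antisymm (hs.2 ht hle) hle)
    push Not at this
    obtain ⟨i, hi⟩ := this
    rw [Finset.prod_eq_zero (Finset.mem_univ i), smul_zero]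
    rw [fwdDiff_iter_pow_eq_zero_of_lt hi]
    simp

theorem integerValued_of_isRepresentedIn {𝓒 : ∀ A : Type, (List A → ℕ) → Prop} {k : ℕ}
    {P : MvPolynomial (Fin k) ℚ} (h : IsRepresentedIn 𝓒 P) : IntegerValued P := by
  obtain ⟨A, -, g, -, -, η, hη⟩ := h
  exact IntegerValued.of_nat fun x => ⟨g (dagger η x), by simpa using (hη x).symm⟩

/-! ### Factorizations, one factor at a time -/

section Factorizations

variable {A M : Type} [Monoid M]

theorem mem_factorizations {n : ℕ} {w : List A} {u : Fin n → List A} :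
    u ∈ factorizations n w ↔ (List.ofFn u).flatten = w := by
  simp [factorizations]

/-- The sum of `φ u v` over all `u`, `v` with `w = u v`. -/
def splitSum {X : Type*} [AddCommMonoid X] (φ : List A → List A → X) (w : List A) : X :=
  ∑ i ∈ Finset.range (w.length + 1), φ (w.take i) (w.drop i)

theorem splitSum_nil {X : Type*} [AddCommMonoid X] (φ : List A → List A → X) :
    splitSum φ [] = φ [] [] := by
  simp [splitSum]

theorem splitSum_cons {X : Type*} [AddCommMonoid X] (φ : List A → List A → X) (a : A)
    (w : List A) :
    splitSum φ (a :: w) = φ [] (a :: w) + splitSum (fun u v => φ (a :: u) v) w := by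
  rw [splitSum, List.length_cons, Finset.sum_range_succ', add_comm]
  simp [splitSum]

theorem splitSum_congr {X : Type*} [AddCommMonoid X] {φ ψ : List A → List A → X} {w : List A}
    (h : ∀ u v, u ++ v = w → φ u v = ψ u v) : splitSum φ w = splitSum ψ w :=
  Finset.sum_congr rfl fun i _ => h _ _ (List.take_append_drop i w)

theorem sum_factorizations_succ {X : Type*} [AddCommMonoid X] (n : ℕ) (w : List A)
    (F : (Fin (n + 1) → List A) → X) :
    ∑ u ∈ factorizations (n + 1) w, F u =
      splitSum (fun u v => ∑ t ∈ factorizations n v, F (Fin.cons u t)) w := by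
  rw [splitSum, Finset.sum_sigma']
  refine Finset.sum_bij' (fun u _ => ⟨(u 0).length, Fin.tail u⟩)
    (fun p _ => Fin.cons (w.take p.1) p.2) ?_ ?_ ?_ ?_ ?_
  · intro u hu
    rw [mem_factorizations, List.ofFn_succ, List.flatten_cons] at hu
    rw [Finset.mem_sigma, Finset.mem_range, mem_factorizations]
    subst hu
    refine ⟨by simp, ?_⟩
    simp [Fin.tail_def]
  · rintro ⟨i, t⟩ hp
    rw [Finset.mem_sigma, mem_factorizations] at hp
    rw [mem_factorizations, List.ofFn_succ, List.flatten_cons]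
    simp only [Fin.cons_zero, Fin.cons_succ]
    rw [hp.2]
    exact List.take_append_drop i w
  · intro u hu
    rw [mem_factorizations, List.ofFn_succ, List.flatten_cons] at hu
    subst hu
    simp
  · rintro ⟨i, t⟩ hp
    rw [Finset.mem_sigma, Finset.mem_range] at hp
    have : min i w.length = i := by
      have := hp.1
      simp only at this
      lia
    simp [this]
  · intro u hu
    rw [mem_factorizations, List.ofFn_succ, List.flatten_cons] at hu
    subst hu
    simp

theorem factorizations_zero_sum {X : Type*} [AddCommMonoid X] (w : List A)
    (F : (Fin 0 → List A) → X) :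
    ∑ u ∈ factorizations 0 w, F u = if w = [] then F Fin.elim0 else 0 := by
  classical
  split_ifs with h
  · have : factorizations 0 w = {Fin.elim0} := by
      ext u
      rw [mem_factorizations, Finset.mem_singleton]
      simp [h, eq_iff_true_of_subsingleton]
    rw [this, Finset.sum_singleton]
  · refine Finset.sum_eq_zero fun u hu => ?_
    rw [mem_factorizations] at hu
    exact absurd hu.symm (by simpa using h)

/-- The sum of `π (μ u₁, …, μ uₙ)` over the factorizations of a word into `n` words. -/
noncomputable def polySum (n : ℕ) (μ : FreeMonoid A →* M) (π : (Fin n → M) → ℕ) (w : List A) :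
    ℕ :=
  ∑ u ∈ factorizations n w, π fun i => μ (FreeMonoid.ofList (u i))

theorem polySum_zero (μ : FreeMonoid A →* M) (π : (Fin 0 → M) → ℕ) (w : List A) :
    polySum 0 μ π w = if w = [] then π Fin.elim0 else 0 := by
  rw [polySum, factorizations_zero_sum]
  congr 2
  exact Subsingleton.elim _ _

theorem polySum_succ (n : ℕ) (μ : FreeMonoid A →* M) (π : (Fin (n + 1) → M) → ℕ) (w : List A) :
    polySum (n + 1) μ π w = splitSum (fun u v =>
      polySum n μ (fun m => π (Fin.cons (μ (FreeMonoid.ofList u)) m)) v) w := by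
  rw [polySum, sum_factorizations_succ]
  refine splitSum_congr fun u v _ => Finset.sum_congr rfl fun t _ => ?_
  congr 1
  funext i
  refine Fin.cases ?_ (fun j => ?_) i <;> simp

end Factorizations

/-! ### Polyregular functions are rational -/

section Rational

variable {A : Type}

/-- A function on words belonging to the `ℕ`-span of a finite family of functions whose left
derivatives are `ℕ`-linear combinations of members of the family. -/
structure DerivativeFamily (f : List A → ℕ) where
  /-- the index set -/
  Index : Type
  [fintypeIndex : Fintype Index]
  /-- the members of the family -/
  fn : Index → List A → ℕ
  /-- the coefficients of the left derivatives -/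
  der : Index → A → Index → ℕ
  /-- the coefficients of the function -/
  coeff : Index → ℕ
  fn_cons : ∀ i a w, fn i (a :: w) = ∑ j, der i a j * fn j w
  eq_sum : ∀ w, f w = ∑ i, coeff i * fn i w

attribute [instance] DerivativeFamily.fintypeIndex

theorem DerivativeFamily.isNRational {f : List A → ℕ} (F : DerivativeFamily f) :
    IsNRational A f := by
  classical
  let 𝒜 : WeightedAutomaton ℕ A :=
    { State := F.Index, init := F.coeff, trans := F.der, final := fun i => F.fn i [] }
  have : DecidableEq 𝒜.State := Classical.decEq _
  have h : ∀ w, ((w.map 𝒜.mat).prod.mulVec 𝒜.final) = fun i => F.fn i w := by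
    intro w
    induction w with
    | nil => simp [𝒜]
    | cons a w ih =>
      rw [List.map_cons, List.prod_cons, ← Matrix.mulVec_mulVec, ih]
      funext i
      exact (F.fn_cons i a w).symm
  refine ⟨𝒜, fun w => ?_⟩
  rw [𝒜.value_eq, h, F.eq_sum]
  rfl

/-- Induction on the number of factors. `h y` is the sum in which a portion with image `y` of the
first factor has already been read. On reading a letter, either the first factor ends before it,
leaving a sum with one factor fewer, or it absorbs the letter and `y` is multiplied by its image.
There are finitely many `y`, plus the families of the shorter sums. -/
theorem nonempty_derivativeFamily_polySum {M : Type} [Monoid M] [Finite M]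
    (μ : FreeMonoid A →* M) (n : ℕ) (π : (Fin n → M) → ℕ) :
    Nonempty (DerivativeFamily (polySum n μ π)) := by
  classical
  have := Fintype.ofFinite M
  induction n with
  | zero =>
    refine ⟨{ Index := Unit
              fn := fun _ w => if w = [] then 1 else 0
              der := fun _ _ _ => 0
              coeff := fun _ => π Fin.elim0
              fn_cons := by simp
              eq_sum := fun w => ?_ }⟩
    rw [polySum_zero]
    simp
  | succ n ih =>
    have F := fun m => (ih fun t => π (Fin.cons m t)).some
    set h : M → List A → ℕ := fun y w => splitSum (fun u v =>
      polySum n μ (fun t => π (Fin.cons (y * μ (FreeMonoid.ofList u)) t)) v) w with hh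
    have hcons : ∀ y a w, h y (a :: w) = polySum n μ (fun t => π (Fin.cons y t)) (a :: w) +
        h (y * μ (FreeMonoid.of a)) w := by
      intro y a w
      rw [hh]
      simp only
      rw [splitSum_cons]
      simp only [FreeMonoid.ofList_nil, map_one, mul_one, FreeMonoid.ofList_cons, map_mul,
        mul_assoc]
    refine ⟨{ Index := (Σ m, (F m).Index) ⊕ M
              fn := Sum.elim (fun i => (F i.1).fn i.2) h
              der := fun i a j => match i, j with
                | .inl ⟨m, i⟩, .inl ⟨m', j⟩ =>
                    if e : m' = m then (F m).der i a (e ▸ j) else 0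
                | .inl _, .inr _ => 0
                | .inr y, .inl ⟨m, j⟩ =>
                    if m = y then ∑ i, (F m).coeff i * (F m).der i a j else 0
                | .inr y, .inr y' => if y' = y * μ (FreeMonoid.of a) then 1 else 0
              -- The function itself is `h 1`: nothing has been read yet.
              coeff := Sum.elim 0 fun y => if y = 1 then 1 else 0
              fn_cons := ?_
              eq_sum := fun w => ?_ }⟩
    · rintro (⟨m, i⟩ | y) a w
      · rw [Fintype.sum_sum_type, Fintype.sum_sigma, Fintype.sum_eq_single m]
        · simp [(F m).fn_cons]
        · intro m' hm'
          simp [hm']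
      · rw [Fintype.sum_sum_type, Fintype.sum_sigma, Fintype.sum_eq_single y]
        · simp only [Sum.elim_inr, Sum.elim_inl, hcons, if_true, ite_mul, one_mul, zero_mul,
            Finset.sum_ite_eq', Finset.mem_univ]
          rw [(F y).eq_sum]
          simp only [(F y).fn_cons, Finset.mul_sum, Finset.sum_mul]
          rw [Finset.sum_comm]
          simp only [mul_assoc]
        · intro m' hm'
          simp [hm']
    · rw [polySum_succ]
      simp [hh]

theorem IsNPolyregular.isNRational {f : List A → ℕ} (h : IsNPolyregular A f) :
    IsNRational A f := by
  obtain ⟨d, M, _, _, μ, π, hf⟩ := h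
  obtain ⟨F⟩ := nonempty_derivativeFamily_polySum μ (d + 1) π
  have : f = polySum (d + 1) μ π := funext hf
  exact this ▸ F.isNRational

end Rational

/-! ### Closure properties of functions computed along a fixed morphism -/

section Closure

variable {A M : Type} [Monoid M]

/-- The functions computed by factorizations of some length along the morphism `μ`. -/
def ComputedAlong (μ : FreeMonoid A →* M) (f : List A → ℕ) : Prop :=
  ∃ (d : ℕ) (π : (Fin (d + 1) → M) → ℕ), IsComputedBy d μ π f

theorem IsComputedBy.eq_polySum {d : ℕ} {μ : FreeMonoid A →* M} {π : (Fin (d + 1) → M) → ℕ}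
    {f : List A → ℕ} (h : IsComputedBy d μ π f) : f = polySum (d + 1) μ π := funext h

theorem IsComputedBy.splitSum {d : ℕ} {μ : FreeMonoid A →* M} {π : (Fin (d + 1) → M) → ℕ}
    {f : List A → ℕ} (h : IsComputedBy d μ π f) (χ : M → ℕ) :
    IsComputedBy (d + 1) μ (fun m => χ (m 0) * π (Fin.tail m))
      (splitSum fun u v => χ (μ (FreeMonoid.ofList u)) * f v) := by
  intro w
  change _ = polySum (d + 1 + 1) μ (fun m => χ (m 0) * π (Fin.tail m)) w
  rw [polySum_succ]
  refine splitSum_congr fun u v _ => ?_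
  rw [h.eq_polySum, polySum, polySum, Finset.mul_sum]
  simp

/-- The image of the whole word is the product of the images of its factors, so a weight depending
on it can be absorbed into `π`. -/
theorem IsComputedBy.mul {d : ℕ} {μ : FreeMonoid A →* M} {π : (Fin (d + 1) → M) → ℕ}
    {f : List A → ℕ} (h : IsComputedBy d μ π f) (χ : M → ℕ) :
    IsComputedBy d μ (fun m => χ (List.ofFn m).prod * π m)
      (fun w => χ (μ (FreeMonoid.ofList w)) * f w) := by
  intro w
  beta_reduce
  rw [h w, Finset.mul_sum]
  refine Finset.sum_congr rfl fun u hu => ?_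
  rw [mem_factorizations] at hu
  rw [← hu, FreeMonoid.ofList_flatten, map_list_prod, List.map_ofFn, List.map_ofFn]
  rfl

variable {μ : FreeMonoid A →* M}

/-- If the morphism detects the empty word, factors that are forced to be empty can be prepended.
This brings two functions to a common number of factors before adding them. -/
theorem IsComputedBy.lift {ε : M → ℕ}
    (hε : ∀ w : List A, ε (μ (FreeMonoid.ofList w)) = if w = [] then 1 else 0) {d d' : ℕ}
    (hd : d ≤ d') {π : (Fin (d + 1) → M) → ℕ} {f : List A → ℕ} (h : IsComputedBy d μ π f) :
    ∃ π', IsComputedBy d' μ π' f := by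
  induction d', hd using Nat.le_induction with
  | base => exact ⟨π, h⟩
  | succ d' _ ih =>
    obtain ⟨π', h'⟩ := ih
    have e : f = NRatPoly.splitSum fun u v => ε (μ (FreeMonoid.ofList u)) * f v := by
      funext w
      cases w with
      | nil => simp [splitSum_nil, hε]
      | cons a w => simp only [hε, splitSum_cons]; simp [NRatPoly.splitSum]
    rw [e]
    exact ⟨_, h'.splitSum ε⟩

theorem ComputedAlong.splitSum {f : List A → ℕ} (h : ComputedAlong μ f) (χ : M → ℕ) :
    ComputedAlong μ (splitSum fun u v => χ (μ (FreeMonoid.ofList u)) * f v) := by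
  obtain ⟨d, π, h⟩ := h
  exact ⟨d + 1, _, h.splitSum χ⟩

theorem ComputedAlong.mul {f : List A → ℕ} (h : ComputedAlong μ f) (χ : M → ℕ) :
    ComputedAlong μ (fun w => χ (μ (FreeMonoid.ofList w)) * f w) := by
  obtain ⟨d, π, h⟩ := h
  exact ⟨d, _, h.mul χ⟩

theorem ComputedAlong.const (c : ℕ) : ComputedAlong μ fun _ => c := by
  refine ⟨0, fun _ => c, fun w => ?_⟩
  change c = polySum (0 + 1) μ (fun _ => c) w
  rw [polySum_succ]
  simp only [polySum_zero]
  induction w with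
  | nil => simp [splitSum_nil]
  | cons a w ih => rw [splitSum_cons]; simpa using ih

theorem ComputedAlong.add {ε : M → ℕ}
    (hε : ∀ w : List A, ε (μ (FreeMonoid.ofList w)) = if w = [] then 1 else 0)
    {f g : List A → ℕ} (hf : ComputedAlong μ f) (hg : ComputedAlong μ g) :
    ComputedAlong μ fun w => f w + g w := by
  obtain ⟨d, π, hf⟩ := hf
  obtain ⟨d', π', hg⟩ := hg
  obtain ⟨ρ, hf⟩ := hf.lift hε (le_max_left d d')
  obtain ⟨ρ', hg⟩ := hg.lift hε (le_max_right d d')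
  refine ⟨max d d', fun m => ρ m + ρ' m, fun w => ?_⟩
  beta_reduce
  rw [hf w, hg w, Finset.sum_add_distrib]

theorem ComputedAlong.sum {ε : M → ℕ}
    (hε : ∀ w : List A, ε (μ (FreeMonoid.ofList w)) = if w = [] then 1 else 0)
    {ι : Type*} (s : Finset ι) {f : ι → List A → ℕ} (hf : ∀ i ∈ s, ComputedAlong μ (f i)) :
    ComputedAlong μ fun w => ∑ i ∈ s, f i w := by
  classical
  induction s using Finset.induction_on with
  | empty => simpa using ComputedAlong.const 0
  | insert i s hi ih =>
    simp only [Finset.sum_insert hi]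
    exact (hf i (Finset.mem_insert_self i s)).add hε
      (ih fun j hj => hf j (Finset.mem_insert_of_mem hj))

end Closure

/-! ### Truncated letter counts and products of binomial coefficients -/

section CappedCounts

/-- The natural numbers up to `T`, with addition truncated at `T` (written multiplicatively). -/
def CappedNat (T : ℕ) : Type := {n : ℕ // n ≤ T}

namespace CappedNat

variable {T : ℕ}

/-- The number `n`, truncated at `T`. -/
def cap (T n : ℕ) : CappedNat T := ⟨min n T, min_le_right n T⟩

instance : Finite (CappedNat T) :=
  Finite.of_injective (fun x : CappedNat T => (⟨x.1, Nat.lt_succ_of_le x.2⟩ : Fin (T + 1)))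
    fun x y h => Subtype.ext (by simpa using h)

instance : Monoid (CappedNat T) where
  mul x y := cap T (x.1 + y.1)
  one := cap T 0
  mul_assoc x y z := Subtype.ext (by
    change min (min (x.1 + y.1) T + z.1) T = min (x.1 + min (y.1 + z.1) T) T
    lia)
  one_mul x := Subtype.ext (by
    change min (min 0 T + x.1) T = x.1
    have := x.2
    lia)
  mul_one x := Subtype.ext (by
    change min (x.1 + min 0 T) T = x.1
    have := x.2
    lia)

theorem cap_add (m n : ℕ) : cap T (m + n) = cap T m * cap T n :=
  Subtype.ext (by
    change min (m + n) T = min (min m T + min n T) T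
    lia)

theorem pow_val (x : CappedNat T) (n : ℕ) : (x ^ n).1 = min (n * x.1) T := by
  induction n with
  | zero => rw [pow_zero, zero_mul]; rfl
  | succ n ih =>
    rw [pow_succ]
    change min ((x ^ n).1 + x.1) T = _
    rw [ih, add_mul, one_mul]
    lia

/-- Either `x` is `0`, or `T` copies of it already reach the truncation value. -/
theorem pow_succ_eq (x : CappedNat T) : x ^ (T + 1) = x ^ T := by
  refine Subtype.ext ?_
  rw [pow_val, pow_val]
  rcases Nat.eq_zero_or_pos x.1 with h | h
  · simp [h]
  · have : T * 1 ≤ T * x.1 := Nat.mul_le_mul_left T h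
    rw [add_mul]
    lia

end CappedNat

theorem isAperiodic_cappedNat (A : Type) (T : ℕ) : IsAperiodic (A → CappedNat T) :=
  fun x => ⟨T, funext fun a => CappedNat.pow_succ_eq (x a)⟩

variable {A : Type} [DecidableEq A]

/-- The morphism counting the occurrences of each letter, up to `T`. -/
def cappedCount (A : Type) [DecidableEq A] (T : ℕ) : FreeMonoid A →* (A → CappedNat T) :=
  FreeMonoid.lift fun a b => CappedNat.cap T (if a = b then 1 else 0)

theorem cappedCount_ofList (T : ℕ) (w : List A) (b : A) :
    cappedCount A T (FreeMonoid.ofList w) b = CappedNat.cap T (w.count b) := by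
  induction w with
  | nil => rfl
  | cons a w ih =>
    rw [FreeMonoid.ofList_cons, map_mul, Pi.mul_apply, ih, List.count_cons, add_comm,
      CappedNat.cap_add]
    congr 1
    simp [cappedCount]

theorem cappedCount_val (T : ℕ) (w : List A) (b : A) :
    (cappedCount A T (FreeMonoid.ofList w) b).1 = min (w.count b) T := by
  rw [cappedCount_ofList]
  rfl

open Classical in
theorem exists_detect_nil {T : ℕ} (hT : 2 ≤ T) : ∃ ε : (A → CappedNat T) → ℕ,
    ∀ w : List A, ε (cappedCount A T (FreeMonoid.ofList w)) = if w = [] then 1 else 0 := by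
  refine ⟨fun m => if ∀ a, (m a).1 = 0 then 1 else 0, fun w => ?_⟩
  simp only [cappedCount_val]
  congr 1
  rw [eq_iff_iff, List.eq_nil_iff_forall_not_mem]
  refine forall_congr' fun a => ?_
  rw [← List.count_eq_zero]
  lia

open Classical in
theorem exists_detect_singleton {T : ℕ} (hT : 2 ≤ T) (x : A) : ∃ ε : (A → CappedNat T) → ℕ,
    ∀ w : List A, ε (cappedCount A T (FreeMonoid.ofList w)) = if w = [x] then 1 else 0 := by
  refine ⟨fun m => if ∀ a, (m a).1 = if a = x then 1 else 0 then 1 else 0, fun w => ?_⟩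
  simp only [cappedCount_val]
  congr 1
  rw [eq_iff_iff]
  constructor
  · intro h
    have hw : w = List.replicate w.length x := List.eq_replicate_of_mem fun a ha => by
      by_contra hax
      have h1 := h a
      rw [if_neg hax] at h1
      have := List.count_pos_iff.2 ha
      lia
    have h1 := h x
    rw [hw, if_pos rfl, List.count_replicate_self] at h1
    rw [hw, (by lia : w.length = 1)]
    rfl
  · rintro rfl a
    rcases eq_or_ne a x with rfl | h
    · simp; lia
    · rw [if_neg h, List.count_eq_zero_of_not_mem (by simpa using h)]
      simp

/-- The product over all letters of the binomial coefficients `(|w|_i - K choose a_i)`, with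
truncated subtraction. -/
def binomialCount [Fintype A] (K : ℕ) (a : A → ℕ) (w : List A) : ℕ :=
  ∏ i, (w.count i - K).choose (a i)

/-- Pascal's rule in the coordinate `x`; if `w.count x < K`, the truncated difference is `0` before
and after, so nothing is added. -/
theorem binomialCount_cons [Fintype A] (K : ℕ) (a : A → ℕ) (x : A) (w : List A) :
    binomialCount K a (x :: w) = binomialCount K a w +
      if K ≤ w.count x ∧ a x ≠ 0 then
        binomialCount K (Function.update a x (a x - 1)) w else 0 := by
  have h1 : ∏ i ∈ Finset.univ.erase x, ((x :: w).count i - K).choose (a i) =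
      ∏ i ∈ Finset.univ.erase x, (w.count i - K).choose (a i) :=
    Finset.prod_congr rfl fun i hi => by
      rw [List.count_cons_of_ne (Finset.ne_of_mem_erase hi).symm]
  have h2 : ∏ i ∈ Finset.univ.erase x,
      (w.count i - K).choose (Function.update a x (a x - 1) i) =
      ∏ i ∈ Finset.univ.erase x, (w.count i - K).choose (a i) :=
    Finset.prod_congr rfl fun i hi => by rw [Function.update_of_ne (Finset.ne_of_mem_erase hi)]
  simp only [binomialCount]
  rw [← Finset.mul_prod_erase _ _ (Finset.mem_univ x), h1,
    ← Finset.mul_prod_erase _ _ (Finset.mem_univ x),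
    ← Finset.mul_prod_erase Finset.univ (fun i => (w.count i - K).choose
      (Function.update a x (a x - 1) i)) (Finset.mem_univ x), h2, Function.update_self,
    List.count_cons_self]
  split_ifs with h
  · obtain ⟨b, hb⟩ := Nat.exists_eq_succ_of_ne_zero h.2
    rw [hb, Nat.succ_sub h.1, Nat.choose_succ_succ, Nat.succ_sub_one]
    ring
  · rw [add_zero]
    congr 1
    by_cases ha : a x = 0
    · simp [ha]
    · have : w.count x < K := by
        by_contra hK
        exact h ⟨not_lt.1 hK, ha⟩
      rw [Nat.sub_eq_zero_of_le (by lia), Nat.sub_eq_zero_of_le (by lia)]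

/-- `binomialCount K a w` counts the ways to choose, for each letter `i`, `a i` occurrences that are
followed by at least `K` further occurrences of `i`. The sum sorts these choices by the leftmost
chosen position: `x` is its letter and the inner `v` the suffix after it, in which the other
positions are chosen. -/
theorem binomialCount_eq_sum [Fintype A] (K : ℕ) {a : A → ℕ} (ha : ∃ i, a i ≠ 0) (w : List A) :
    binomialCount K a w = ∑ x ∈ Finset.univ.filter fun x => a x ≠ 0,
      splitSum (fun _ v => splitSum (fun u v => (if u = [x] then 1 else 0) *
        ((if K ≤ v.count x then 1 else 0) *
          binomialCount K (Function.update a x (a x - 1)) v)) v) w := by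
  have hin : ∀ (f : List A → ℕ) (x : A) (v : List A),
      splitSum (fun u v => (if u = [x] then 1 else 0) * f v) v =
        match v with
        | [] => 0
        | y :: v => if y = x then f v else 0 := by
    intro f x v
    cases v with
    | nil => simp [splitSum_nil]
    | cons y v =>
      rw [splitSum_cons]
      cases v with
      | nil => simp [splitSum_nil]
      | cons z v => rw [splitSum_cons]; simp [splitSum]
  simp only [hin]
  induction w with
  | nil =>
    obtain ⟨i, hi⟩ := ha
    simp only [splitSum_nil, Finset.sum_const_zero]
    exact Finset.prod_eq_zero (Finset.mem_univ i)
      (by simp [Nat.choose_eq_zero_of_lt (Nat.pos_of_ne_zero hi)])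
  | cons x w ih =>
    simp only [splitSum_cons, Finset.sum_add_distrib]
    rw [binomialCount_cons, ih, add_comm]
    congr 1
    simp only [Finset.sum_ite_eq, Finset.mem_filter, Finset.mem_univ, true_and]
    by_cases h : a x = 0 <;> by_cases h' : K ≤ w.count x <;> simp [h, h']

/-- Induction on the number of chosen positions: the leftmost one costs two more factors, the prefix
before it and the single letter itself. A cap `T ≥ K` decides whether `K ≤ v.count x`. -/
theorem computedAlong_binomialCount [Fintype A] {K T : ℕ} (hT : 2 ≤ T) (hK : K ≤ T)
    (a : A → ℕ) : ComputedAlong (cappedCount A T) (binomialCount K a) := by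
  classical
  obtain ⟨ε, hε⟩ := exists_detect_nil (A := A) hT
  induction hn : ∑ i, a i generalizing a with
  | zero =>
    have : a = fun _ => 0 := funext fun i => by simpa using Finset.sum_eq_zero_iff.1 hn i
    have h : binomialCount K a = fun _ => 1 := by
      funext w
      simp [binomialCount, this]
    rw [h]
    exact ComputedAlong.const 1
  | succ n ih =>
    have ha : ∃ i, a i ≠ 0 := by
      by_contra! h0
      simp [h0] at hn
    have h : binomialCount K a = _ := funext (binomialCount_eq_sum K ha)
    rw [h]
    refine ComputedAlong.sum hε _ fun x hx => ?_
    have hx := (Finset.mem_filter.1 hx).2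
    have hsum : ∑ i, Function.update a x (a x - 1) i = n := by
      rw [← Finset.add_sum_erase _ _ (Finset.mem_univ x), Function.update_self,
        Finset.sum_congr rfl fun j hj => Function.update_of_ne (Finset.ne_of_mem_erase hj) _ a]
      rw [← Finset.add_sum_erase _ _ (Finset.mem_univ x)] at hn
      lia
    obtain ⟨δ, hδ⟩ := exists_detect_singleton hT x
    have h1 := (((ih _ hsum).mul fun m => if K ≤ (m x).1 then 1 else 0).splitSum δ).splitSum
      fun _ => 1
    simp only [hδ, one_mul, cappedCount_val, le_min_iff, hK, and_true] at h1
    exact h1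

end CappedCounts

/-! ### Decomposition into pieces, and the equivalences -/

section Pieces

/-- For `b < K` the indicator function of `b`, and otherwise the binomial coefficient
`(x - K choose b - K)`, restricted to the numbers `x ≥ K`. -/
def pieceFun (K b x : ℕ) : ℕ :=
  (if if b < K then x = b else K ≤ x then 1 else 0) * (x - K).choose (b - K)

theorem pieceFun_of_lt {K b : ℕ} (h : b < K) (x : ℕ) :
    pieceFun K b x = if x = b then 1 else 0 := by
  simp [pieceFun, h, Nat.sub_eq_zero_of_le h.le]

theorem pieceFun_add (K b x : ℕ) :
    pieceFun K (K + b) x = if K ≤ x then (x - K).choose b else 0 := by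
  simp [pieceFun]

/-- Below `K` a power is tabulated value by value; from `K` on it is given by its Newton expansion
at `K`. The expression `newtonCoeff (min b K) t (b - K)` covers both: it is `b ^ t` for `b < K` and
the difference of order `b - K` at `K` otherwise. -/
theorem pow_eq_sum_pieceFun (K x : ℕ) {t m : ℕ} (hm : t < m) :
    x ^ t = ∑ b ∈ Finset.range (K + m), newtonCoeff (min b K) t (b - K) * pieceFun K b x := by
  rw [Finset.sum_range_add]
  have h1 : ∀ b ∈ Finset.range K, newtonCoeff (min b K) t (b - K) * pieceFun K b x =
      if x = b then x ^ t else 0 := by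
    intro b hb
    have hb := Finset.mem_range.1 hb
    rw [pieceFun_of_lt hb, min_eq_left hb.le, Nat.sub_eq_zero_of_le hb.le,
      newtonCoeff_zero_right]
    split_ifs with h <;> simp [h]
  have h2 : ∀ b ∈ Finset.range m, newtonCoeff (min (K + b) K) t (K + b - K) *
      pieceFun K (K + b) x = if K ≤ x then newtonCoeff K t b * (x - K).choose b else 0 := by
    intro b _
    rw [pieceFun_add, min_eq_right (Nat.le_add_right K b), Nat.add_sub_cancel_left]
    split_ifs with h <;> simp
  rw [Finset.sum_congr rfl h1, Finset.sum_congr rfl h2, Finset.sum_ite_eq]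
  split_ifs with h h' h'
  · exact absurd (Finset.mem_range.1 h) (by lia)
  · simp
  · rw [zero_add, ← pow_eq_sum_newtonCoeff h' t hm]
  · exact absurd (Finset.mem_range.2 (not_le.1 h')) h

/-- The coefficient of `∏ pieceFun K (b i) (x i)` in the decomposition of `P`. -/
noncomputable def pieceCoeff {σ : Type*} [Fintype σ] (K : ℕ) (b : σ → ℕ)
    (P : MvPolynomial σ ℚ) : ℚ :=
  newtonFun (fun i => b i - K) (fun i => min (b i) K) P

theorem eval_eq_sum_pieceFun {σ : Type*} [Fintype σ] [DecidableEq σ] (P : MvPolynomial σ ℚ)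
    (K : ℕ) {m : ℕ} (hm : ∀ t ∈ P.support, ∀ i, t i < m) (x : σ → ℕ) :
    MvPolynomial.eval (fun i => (x i : ℚ)) P =
      ∑ b ∈ Fintype.piFinset fun _ : σ => Finset.range (K + m),
        pieceCoeff K b P * ∏ i, (pieceFun K (b i) (x i) : ℚ) := by
  rw [eval_eq_prodFun]
  refine prodFun_expand (R := ℚ) (fun _ => Finset.range (K + m))
    (fun _ j t => (newtonCoeff (min j K) t (j - K) : ℚ)) (fun i j => (pieceFun K j (x i) : ℚ)) _ P
    fun t ht i => ?_
  rw [← Nat.cast_pow, pow_eq_sum_pieceFun K (x i) (hm t ht i)]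
  push_cast
  rfl

/-- A piece coefficient has order `0` in every coordinate whose base point is below `K`, which is
exactly the case allowed by the uniform positivity statement. -/
theorem exists_pieceCoeff_eq_natCast {σ : Type*} [Fintype σ] {P : MvPolynomial σ ℚ}
    (h : StronglyNonneg P) (hP : IntegerValued P) :
    ∃ K : ℕ, ∀ b : σ → ℕ, ∃ d : ℕ, pieceCoeff K b P = d := by
  obtain ⟨K, hK⟩ := exists_uniform_newtonFun_nonneg h
  refine ⟨K, fun b => ?_⟩
  obtain ⟨m, hm⟩ := exists_int_newtonFun (P := P) (fun x => hP fun i => x i) (fun i => b i - K)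
    (fun i => min (b i) K)
  have h0 := hK (fun i => b i - K) (fun i => min (b i) K) fun i => by lia
  refine ⟨m.toNat, ?_⟩
  rw [pieceCoeff, hm]
  rw [hm] at h0
  exact_mod_cast (Int.toNat_of_nonneg (by exact_mod_cast h0)).symm

theorem dagger_count {k : ℕ} (x : Fin k → ℕ) (i : Fin k) :
    (dagger (fun j : Fin k => j) x).count i = x i := by
  rw [dagger, List.count_flatten, List.map_ofFn, List.sum_ofFn]
  simp [List.count_replicate]

/-- Naturality is demanded only on a finite box of indices, so that for given `K` and `m` it is a
finite check; this is what makes it a certificate later. -/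
theorem isRepresentedIn_of_pieceCoeff {k : ℕ} {P : MvPolynomial (Fin k) ℚ} {K m : ℕ}
    (hm : ∀ t ∈ P.support, ∀ i, t i < m)
    (h : ∀ b ∈ Fintype.piFinset fun _ : Fin k => Finset.range (K + m),
      ∃ d : ℕ, pieceCoeff K b P = d) :
    IsRepresentedIn IsStarFreeNPolyregular P := by
  classical
  have h' : ∀ b, ∃ d : ℕ, b ∈ Fintype.piFinset (fun _ : Fin k => Finset.range (K + m)) →
      pieceCoeff K b P = d := by
    intro b
    by_cases hb : b ∈ Fintype.piFinset fun _ : Fin k => Finset.range (K + m)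
    · exact (h b hb).imp fun d hd _ => hd
    · exact ⟨0, fun hb' => absurd hb' hb⟩
  choose d hd using h'
  set g : List (Fin k) → ℕ := fun w => ∑ b ∈ Fintype.piFinset fun _ : Fin k => Finset.range (K + m),
    d b * ∏ i, pieceFun K (b i) (w.count i) with hg
  -- The cap `K + 2` is at least `2`, to recognise empty words and single letters, and at least `K`,
  -- to decide the conditions in the pieces.
  have hcomp : ComputedAlong (cappedCount (Fin k) (K + 2)) g := by
    obtain ⟨ε, hε⟩ := exists_detect_nil (A := Fin k) (T := K + 2) (by lia)
    refine ComputedAlong.sum hε _ fun b _ => ?_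
    have h1 := ((computedAlong_binomialCount (A := Fin k) (K := K) (T := K + 2) (by lia) (by lia)
      fun i => b i - K).mul fun c => ∏ i, if if b i < K then (c i).1 = b i else K ≤ (c i).1
        then 1 else 0).mul fun _ => d b
    convert h1 using 3 with w
    simp only [pieceFun, Finset.prod_mul_distrib, binomialCount, cappedCount_val]
    congr 1
    refine Finset.prod_congr rfl fun i _ => ?_
    congr 1
    rw [eq_iff_iff]
    split_ifs with hb <;> lia
  obtain ⟨n, π, hπ⟩ := hcomp
  refine ⟨Fin k, inferInstance, g, ⟨n, _, _, inferInstance, _, π, isAperiodic_cappedNat _ _, hπ⟩,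
    fun u v huv => ?_, fun i => i, fun x => ?_⟩
  · simp only [hg, huv.count_eq]
  · simp only [hg, dagger_count]
    rw [eval_eq_sum_pieceFun P K hm]
    push_cast
    exact Finset.sum_congr rfl fun b hb => by rw [hd b hb]

theorem IsRepresentedIn.mono {𝓒 𝓓 : ∀ A : Type, (List A → ℕ) → Prop} {k : ℕ}
    {P : MvPolynomial (Fin k) ℚ} (h : ∀ A f, 𝓒 A f → 𝓓 A f) (hP : IsRepresentedIn 𝓒 P) :
    IsRepresentedIn 𝓓 P := by
  obtain ⟨A, hA, g, hg, hr⟩ := hP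
  exact ⟨A, hA, g, h A g hg, hr⟩

theorem tfae_represented {k : ℕ} (P : MvPolynomial (Fin k) ℚ) :
    List.TFAE [
      ScaledPolyStrNNeg P ∧ IntegerValued P,
      IsRepresentedIn IsNRational P,
      IsRepresentedIn IsNPolyregular P,
      IsRepresentedIn IsStarFreeNPolyregular P,
      IsStronglyNaturalBinomial P] := by
  rw [scaledPolyStrNNeg_iff]
  tfae_have 1 → 4 := fun ⟨h, hP⟩ => by
    obtain ⟨K, hK⟩ := exists_pieceCoeff_eq_natCast h hP
    exact isRepresentedIn_of_pieceCoeff apply_lt_totalDegree_succ fun b _ => hK b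
  tfae_have 4 → 3 := IsRepresentedIn.mono fun A f ⟨d, M, _, hM, μ, π, _, h⟩ =>
    ⟨d, M, _, hM, μ, π, h⟩
  tfae_have 3 → 2 := IsRepresentedIn.mono fun A f => IsNPolyregular.isNRational
  tfae_have 2 → 1 := fun h =>
    ⟨stronglyNonneg_of_isRepresentedIn h, integerValued_of_isRepresentedIn h⟩
  tfae_have 1 → 5 := fun ⟨h, hP⟩ => isStronglyNaturalBinomial_of_stronglyNonneg h hP
  tfae_have 5 → 1 := fun h => ⟨h.stronglyNonneg, h.integerValued⟩
  tfae_finish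

end Pieces

/-! ### Primitive recursive evaluation of product functionals -/

section Computability

/-- The row of the numbers `newtonCoeff K t a`, `a ≤ t`. -/
def newtonRow (K t : ℕ) : List ℕ :=
  Nat.rec [1] (fun t r => (List.range (t + 2)).map fun a =>
    a * r.getD (a - 1) 0 + (K + a) * r.getD a 0) t

theorem newtonRow_getD (K t a : ℕ) : (newtonRow K t).getD a 0 = newtonCoeff K t a := by
  induction t generalizing a with
  | zero => cases a <;> rfl
  | succ t ih =>
    have h : newtonRow K (t + 1) = (List.range (t + 2)).map fun a =>
      a * (newtonRow K t).getD (a - 1) 0 + (K + a) * (newtonRow K t).getD a 0 := rfl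
    rw [h]
    rcases lt_or_ge a (t + 2) with ha | ha
    · rw [List.getD_eq_getElem _ _ (by simpa using ha), List.getElem_map, List.getElem_range, ih, ih]
      cases a with
      | zero => simp [newtonCoeff]
      | succ a => simp [newtonCoeff, add_assoc]
    · rw [List.getD_eq_default _ _ (by simpa using ha), newtonCoeff_eq_zero (by lia)]

/-- Computing whole rows turns the recursion for `newtonCoeff`, which calls several values of `a`,
into primitive recursion on `t` alone. -/
theorem primrec_newtonRow : Primrec₂ newtonRow := by
  have hstep : Primrec₂ fun (p : (ℕ × ℕ) × ℕ × List ℕ) (a : ℕ) =>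
      a * p.2.2.getD (a - 1) 0 + (p.1.1 + a) * p.2.2.getD a 0 := by
    have hr : Primrec fun q : ((ℕ × ℕ) × ℕ × List ℕ) × ℕ => q.1.2.2 :=
      Primrec.snd.comp (Primrec.snd.comp Primrec.fst)
    refine Primrec.nat_add.comp (Primrec.nat_mul.comp Primrec.snd
      ((Primrec.list_getD 0).comp hr (Primrec.nat_sub.comp Primrec.snd (Primrec.const 1))))
      (Primrec.nat_mul.comp (Primrec.nat_add.comp
        (Primrec.fst.comp (Primrec.fst.comp Primrec.fst)) Primrec.snd)
        ((Primrec.list_getD 0).comp hr Primrec.snd))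
  exact Primrec.nat_rec' (f := fun p : ℕ × ℕ => p.2) (g := fun _ => [1])
    (h := fun p s => (List.range (s.1 + 2)).map fun a =>
      a * s.2.getD (a - 1) 0 + (p.1 + a) * s.2.getD a 0)
    Primrec.snd (Primrec.const _)
    (Primrec.list_map (Primrec.list_range.comp (Primrec.nat_add.comp
      (Primrec.fst.comp Primrec.snd) (Primrec.const 2))) hstep)

/-- Integers are encoded with `n` as `2 n` and `-(n+1)` as `2 n + 1`; parity of the code gives the
sign. -/
theorem primrec_toNat : Primrec Int.toNat := by
  refine (Primrec.ite (c := fun z : ℤ => Encodable.encode z % 2 = 0)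
    (Primrec.eq.comp (Primrec.nat_mod.comp Primrec.encode (Primrec.const 2)) (Primrec.const 0))
    (Primrec.nat_div.comp Primrec.encode (Primrec.const 2)) (Primrec.const 0)).of_eq fun z => ?_
  cases z with
  | ofNat n =>
    have : Encodable.encode (Int.ofNat n) = 2 * n := rfl
    simp only [this]
    rw [if_pos (by lia)]
    change _ = n
    lia
  | negSucc n =>
    have : Encodable.encode (Int.negSucc n) = 2 * n + 1 := rfl
    simp only [this]
    rw [if_neg (by lia), Int.toNat_negSucc]

theorem primrec_neg_toNat : Primrec fun z : ℤ => (-z).toNat := by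
  refine (Primrec.ite (c := fun z : ℤ => Encodable.encode z % 2 = 0)
    (Primrec.eq.comp (Primrec.nat_mod.comp Primrec.encode (Primrec.const 2)) (Primrec.const 0))
    (Primrec.const 0) (Primrec.succ.comp
      (Primrec.nat_div.comp Primrec.encode (Primrec.const 2)))).of_eq fun z => ?_
  cases z with
  | ofNat n =>
    have : Encodable.encode (Int.ofNat n) = 2 * n := rfl
    simp only [this]
    rw [if_pos (by lia)]
    simp
  | negSucc n =>
    have : Encodable.encode (Int.negSucc n) = 2 * n + 1 := rfl
    simp only [this, Int.neg_negSucc]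
    rw [if_neg (by lia)]
    lia

/-- Indices of functionals on the powers of an indeterminate: `(true, s, _)` stands for the
coefficient of the `s`-th power, and `(false, a, K)` for the `a`-th difference at `K`. -/
abbrev FunIndex : Type := Bool × ℕ × ℕ

/-- The value of a functional at the `t`-th power. -/
def FunIndex.val (q : FunIndex) (t : ℕ) : ℕ :=
  bif q.1 then (if t = q.2.1 then 1 else 0) else newtonCoeff q.2.2 t q.2.1

theorem FunIndex.primrec_val : Primrec₂ FunIndex.val := by
  have h1 : Primrec fun p : FunIndex × ℕ => p.1.2.1 :=
    Primrec.fst.comp (Primrec.snd.comp Primrec.fst)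
  have h2 : Primrec fun p : FunIndex × ℕ => p.1.2.2 :=
    Primrec.snd.comp (Primrec.snd.comp Primrec.fst)
  refine (Primrec.cond (Primrec.fst.comp Primrec.fst)
    (Primrec.ite (Primrec.eq.comp Primrec.snd h1) (Primrec.const 1) (Primrec.const 0))
    ((Primrec.list_getD 0).comp (primrec_newtonRow.comp h2 Primrec.snd) h1)).of_eq fun p => ?_
  rw [newtonRow_getD]
  rfl

/-- The value at a monomial of the product of the functionals with indices in the list `l`. -/
def termProd (k : ℕ) (l : List FunIndex) (e : List ℕ) : ℕ :=
  ((List.range k).map fun i => (l.getD i (false, 0, 0)).val (e.getD i 0)).prod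

theorem primrec_termProd :
    Primrec fun p : ℕ × List FunIndex × List ℕ => termProd p.1 p.2.1 p.2.2 := by
  have hprod : Primrec (List.prod : List ℕ → ℕ) :=
    (Primrec.list_foldr Primrec.id (Primrec.const 1)
      (Primrec.nat_mul.comp (Primrec.fst.comp Primrec.snd)
        (Primrec.snd.comp Primrec.snd)).to₂).of_eq fun l => List.prod_eq_foldr.symm
  refine hprod.comp (Primrec.list_map (Primrec.list_range.comp Primrec.fst) ?_)
  exact FunIndex.primrec_val.comp
    ((Primrec.list_getD _).comp (Primrec.fst.comp (Primrec.snd.comp Primrec.fst)) Primrec.snd)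
    ((Primrec.list_getD _).comp (Primrec.snd.comp (Primrec.snd.comp Primrec.fst)) Primrec.snd)

/-- Addition of a term to a fraction `(p - q) / d`, represented by the triple `(p, q, d)`. -/
def fracStep (k : ℕ) (l : List FunIndex) (s : ℕ × ℕ × ℕ) (u : (ℤ × ℕ) × List ℕ) : ℕ × ℕ × ℕ :=
  (s.1 * (u.1.2 + 1) + s.2.2 * (u.1.1.toNat * termProd k l u.2),
    s.2.1 * (u.1.2 + 1) + s.2.2 * ((-u.1.1).toNat * termProd k l u.2),
    s.2.2 * (u.1.2 + 1))

/-- The value at a polynomial of the product of the functionals with indices in the list `l`, as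
a fraction `(p - q) / d`, represented by the triple `(p, q, d)`. -/
def codeFrac (c : PolyCode) (l : List FunIndex) : ℕ × ℕ × ℕ :=
  c.2.foldl (fracStep c.1 l) (0, 0, 1)

theorem primrec_codeFrac : Primrec₂ codeFrac := by
  refine Primrec.list_foldl (f := fun p : PolyCode × List FunIndex => p.1.2)
    (g := fun _ => (0, 0, 1))
    (h := fun p s => fracStep p.1.1 p.2 s.1 s.2) (Primrec.snd.comp Primrec.fst)
    (Primrec.const _) ?_
  have hs : Primrec fun p : (PolyCode × List FunIndex) × (ℕ × ℕ × ℕ) × ((ℤ × ℕ) × List ℕ) =>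
      p.2.1 := Primrec.fst.comp Primrec.snd
  have hu : Primrec fun p : (PolyCode × List FunIndex) × (ℕ × ℕ × ℕ) × ((ℤ × ℕ) × List ℕ) =>
      p.2.2 := Primrec.snd.comp Primrec.snd
  have hz := Primrec.fst.comp (Primrec.fst.comp hu)
  have hb := Primrec.succ.comp (Primrec.snd.comp (Primrec.fst.comp hu))
  have hd := Primrec.snd.comp (Primrec.snd.comp hs)
  have ht : Primrec fun p : (PolyCode × List FunIndex) × (ℕ × ℕ × ℕ) × ((ℤ × ℕ) × List ℕ) =>
      termProd p.1.1.1 p.1.2 p.2.2.2 :=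
    primrec_termProd.comp (Primrec.pair (Primrec.fst.comp (Primrec.fst.comp Primrec.fst))
      (Primrec.pair (Primrec.snd.comp Primrec.fst) (Primrec.snd.comp hu)))
  refine Primrec.pair (Primrec.nat_add.comp (Primrec.nat_mul.comp (Primrec.fst.comp hs) hb)
    (Primrec.nat_mul.comp hd (Primrec.nat_mul.comp (primrec_toNat.comp hz) ht)))
    (Primrec.pair (Primrec.nat_add.comp
      (Primrec.nat_mul.comp (Primrec.fst.comp (Primrec.snd.comp hs)) hb)
      (Primrec.nat_mul.comp hd (Primrec.nat_mul.comp (primrec_neg_toNat.comp hz) ht)))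
      (Primrec.nat_mul.comp hd hb))

/-- The value of a fraction represented by a triple. -/
def fracVal (s : ℕ × ℕ × ℕ) : ℚ := ((s.1 : ℚ) - s.2.1) / s.2.2

theorem prodFun_toPoly (c : PolyCode) (w : Fin c.1 → ℕ → ℚ) :
    prodFun w c.toPoly = (c.2.map fun u => ((u.1.1 : ℚ) / ((u.1.2 : ℚ) + 1)) *
      ∏ i : Fin c.1, w i (u.2.getD i 0)).sum := by
  rw [PolyCode.toPoly, map_list_sum, List.map_map]
  congr 1
  refine List.map_congr_left fun u _ => ?_
  rw [Function.comp_apply, prodFun_monomial]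
  rfl

theorem termProd_eq (k : ℕ) (l : List FunIndex) (e : List ℕ) :
    termProd k l e = ∏ i : Fin k, (l.getD i (false, 0, 0)).val (e.getD i 0) := by
  rw [termProd, ← Finset.prod_range fun i => (l.getD i (false, 0, 0)).val (e.getD i 0)]
  exact (Multiset.prod_coe _).symm

/-- Values, coefficients and differences of the coded polynomial are all computed this way. Positive
and negative parts of the numerator are kept apart so that the arithmetic stays in `ℕ`. -/
theorem fracVal_codeFrac (c : PolyCode) (l : List FunIndex) :
    0 < (codeFrac c l).2.2 ∧ fracVal (codeFrac c l) =
      prodFun (fun (i : Fin c.1) t => ((l.getD i (false, 0, 0)).val t : ℚ)) c.toPoly := by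
  obtain ⟨k, L⟩ := c
  rw [prodFun_toPoly]
  -- The accumulator of the fold is generalized to make the induction on the list of terms go
  -- through.
  suffices H : ∀ s : ℕ × ℕ × ℕ, 0 < s.2.2 → 0 < (L.foldl (fracStep k l) s).2.2 ∧
      fracVal (L.foldl (fracStep k l) s) = fracVal s + (L.map fun u =>
        ((u.1.1 : ℚ) / ((u.1.2 : ℚ) + 1)) *
          ∏ i : Fin k, ((l.getD i (false, 0, 0)).val (u.2.getD i 0) : ℚ)).sum by
    have := H (0, 0, 1) one_pos
    simpa [fracVal, codeFrac] using this
  induction L with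
  | nil => intro s hs; exact ⟨hs, by simp⟩
  | cons u L ih =>
    intro s hs
    have hs' : 0 < (fracStep k l s u).2.2 := Nat.mul_pos hs (Nat.succ_pos _)
    obtain ⟨h1, h2⟩ := ih _ hs'
    refine ⟨h1, ?_⟩
    rw [List.foldl_cons, h2, List.map_cons, List.sum_cons, ← add_assoc]
    congr 1
    have hz : (u.1.1 : ℚ) = (u.1.1.toNat : ℚ) - ((-u.1.1).toNat : ℚ) := by
      exact_mod_cast (Int.toNat_sub_toNat_neg u.1.1).symm
    have hs0 : (s.2.2 : ℚ) ≠ 0 := by exact_mod_cast hs.ne'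
    have hu0 : (u.1.2 : ℚ) + 1 ≠ 0 := by positivity
    rw [hz]
    simp only [fracVal, fracStep, termProd_eq]
    push_cast
    field_simp
    ring

end Computability

/-! ### Certificates and decidability -/

section Certificates

/-- Unbounded search through the codes of possible witnesses. -/
theorem rePred_exists {α β : Type*} [Primcodable α] [Primcodable β] {r : α → β → Prop}
    (h : PrimrecRel r) : REPred fun a => ∃ b, r a b := by
  classical
  have h1 : Primrec₂ fun (a : α) (n : ℕ) =>
      ((Encodable.decode (α := β) n).map fun b => decide (r a b)).getD false :=
    Primrec.option_getD.comp
      (Primrec.option_map (Primrec.decode.comp Primrec.snd)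
        (h.decide.comp (Primrec.fst.comp Primrec.fst) Primrec.snd))
      (Primrec.const false)
  have h2 : Partrec fun a => Nat.rfind fun n =>
      Part.some (((Encodable.decode (α := β) n).map fun b => decide (r a b)).getD false) :=
    Partrec.rfind h1.to_comp.partrec
  refine h2.dom_re.of_eq fun a => ?_
  refine Nat.rfind_dom'.trans ?_
  constructor
  · rintro ⟨n, hn, -⟩
    rw [Part.mem_some_iff] at hn
    rcases hb : Encodable.decode (α := β) n with _ | b
    · simp [hb] at hn
    · exact ⟨b, by simpa [hb] using hn⟩
  · rintro ⟨b, hb⟩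
    exact ⟨Encodable.encode b, by simp [hb], fun _ => trivial⟩

/-- Post's theorem: witnesses for the property and for its negation are searched for, and one of the
searches succeeds. -/
theorem computablePred_of_exists {α β γ : Type*} [Primcodable α] [Primcodable β] [Primcodable γ]
    {p : α → Prop} {r : α → β → Prop} {s : α → γ → Prop} (hr : PrimrecRel r) (hs : PrimrecRel s)
    (h : ∀ a, p a ↔ ∃ b, r a b) (h' : ∀ a, ¬ p a ↔ ∃ b, s a b) : ComputablePred p :=
  ComputablePred.computable_iff_re_compl_re'.2
    ⟨(rePred_exists hr).of_eq fun a => (h a).symm, (rePred_exists hs).of_eq fun a => (h' a).symm⟩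

/-- The list of all lists of `k` numbers less than `n`. -/
def listBox (n k : ℕ) : List (List ℕ) :=
  Nat.rec [[]] (fun _ B => (List.range n).flatMap fun x => B.map (List.cons x)) k

theorem mem_listBox {n k : ℕ} {b : List ℕ} :
    b ∈ listBox n k ↔ b.length = k ∧ ∀ x ∈ b, x < n := by
  induction k generalizing b with
  | zero =>
    have h : listBox n 0 = [[]] := rfl
    rw [h]
    simp +contextual
  | succ k ih =>
    have h : listBox n (k + 1) =
      (List.range n).flatMap fun x => (listBox n k).map (List.cons x) := rfl
    rw [h]
    cases b with
    | nil => simp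
    | cons y b => simp [ih]; tauto

theorem primrec_listBox : Primrec₂ listBox := by
  have h1 : Primrec₂ fun (q : ((ℕ × ℕ) × ℕ × List (List ℕ)) × ℕ) (b : List ℕ) => q.2 :: b :=
    Primrec.list_cons.comp (Primrec.snd.comp Primrec.fst) Primrec.snd
  exact Primrec.nat_rec' (f := fun p : ℕ × ℕ => p.2) (g := fun _ => [[]])
    (h := fun p s => (List.range p.1).flatMap fun x => s.2.map (List.cons x))
    Primrec.snd (Primrec.const _)
    (Primrec.list_flatMap (Primrec.list_range.comp (Primrec.fst.comp Primrec.fst))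
      (Primrec.list_map (Primrec.snd.comp (Primrec.snd.comp Primrec.fst)) h1))

/-- The exponents `e` (of `k` indeterminates) are less than `m`. -/
def ExpLt (k m : ℕ) (e : List ℕ) : Prop := ∀ i ∈ List.range k, e.getD i 0 < m

/-- The fraction represented by a triple is a natural number. -/
def IsNatFrac (s : ℕ × ℕ × ℕ) : Prop := s.2.1 ≤ s.1 ∧ (s.1 - s.2.1) % s.2.2 = 0

/-- The fraction represented by a triple is not an integer. -/
def NotIntFrac (s : ℕ × ℕ × ℕ) : Prop := ¬ ((s.1 - s.2.1) + (s.2.1 - s.1)) % s.2.2 = 0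

theorem isNatFrac_iff {s : ℕ × ℕ × ℕ} (hs : 0 < s.2.2) :
    IsNatFrac s ↔ ∃ d : ℕ, fracVal s = d := by
  obtain ⟨p, q, d⟩ := s
  have hd : (d : ℚ) ≠ 0 := by exact_mod_cast hs.ne'
  simp only [IsNatFrac, fracVal]
  constructor
  · rintro ⟨h1, h2⟩
    obtain ⟨e, he⟩ := Nat.dvd_of_mod_eq_zero h2
    refine ⟨e, ?_⟩
    rw [← Nat.cast_sub h1, he, Nat.cast_mul, mul_div_cancel_left₀ _ hd]
  · rintro ⟨e, he⟩
    rw [div_eq_iff hd] at he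
    have : p = q + e * d := by
      have : (p : ℚ) = q + e * d := by linarith
      exact_mod_cast this
    subst this
    exact ⟨Nat.le_add_right _ _, by simp⟩

theorem notIntFrac_iff {s : ℕ × ℕ × ℕ} (hs : 0 < s.2.2) :
    NotIntFrac s ↔ ¬ ∃ d : ℤ, fracVal s = d := by
  rw [NotIntFrac, not_iff_not]
  obtain ⟨p, q, d⟩ := s
  have hd : (d : ℚ) ≠ 0 := by exact_mod_cast hs.ne'
  simp only [fracVal]
  rw [← Nat.dvd_iff_mod_eq_zero, ← Int.natCast_dvd_natCast]
  have h1 : (d : ℤ) ∣ ((p - q + (q - p) : ℕ) : ℤ) ↔ (d : ℤ) ∣ (p : ℤ) - q := by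
    rcases le_total p q with h | h
    · rw [Nat.sub_eq_zero_of_le h, zero_add, Nat.cast_sub h, dvd_sub_comm]
    · rw [Nat.sub_eq_zero_of_le h, add_zero, Nat.cast_sub h]
  rw [h1]
  refine exists_congr fun e => ?_
  rw [div_eq_iff hd]
  constructor
  · intro h
    have := congrArg (Int.cast : ℤ → ℚ) h
    push_cast at this
    rw [this, mul_comm]
  · intro h
    rw [mul_comm]
    exact_mod_cast h

/-- The certificates for the membership in `PolyStrNNeg` of an integer-valued polynomial. -/
def PosCert (c : PolyCode) (Km : ℕ × ℕ) : Prop :=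
  (∀ u ∈ c.2, ExpLt c.1 Km.2 u.2) ∧
    ∀ b ∈ listBox (Km.1 + Km.2) c.1,
      IsNatFrac (codeFrac c (b.map fun x => (false, x - Km.1, min x Km.1)))

/-- The list may repeat exponents and its terms may cancel; only this inclusion of the support in
the listed exponents is available. -/
theorem exists_mem_of_coeff_toPoly_ne_zero {c : PolyCode} {t : Fin c.1 →₀ ℕ}
    (h : t ∈ c.toPoly.support) : ∃ u ∈ c.2, ∀ i : Fin c.1, u.2.getD i 0 = t i := by
  classical
  by_contra! hne
  refine MvPolynomial.mem_support_iff.1 h ?_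
  rw [coeff_eq_prodFun, prodFun_toPoly]
  refine List.sum_eq_zero fun x hx => ?_
  obtain ⟨u, hu, rfl⟩ := List.mem_map.1 hx
  obtain ⟨i, hi⟩ := hne u hu
  rw [Finset.prod_eq_zero (Finset.mem_univ i) (if_neg hi), mul_zero]

theorem fracVal_codeFrac_piece (c : PolyCode) (K : ℕ) (b : List ℕ) :
    fracVal (codeFrac c (b.map fun x => (false, x - K, min x K))) =
      pieceCoeff K (fun i : Fin c.1 => b.getD i 0) c.toPoly := by
  rw [(fracVal_codeFrac _ _).2, pieceCoeff, newtonFun]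
  congr 1
  congr 1
  funext i t
  -- The default index must be the image of the default entry `0` for `getD` to commute with `map`.
  have : ((false, 0, 0) : FunIndex) = (false, 0 - K, min 0 K) := by simp
  rw [this, List.getD_map (f := fun x => ((false, x - K, min x K) : FunIndex))]
  rfl

theorem PosCert.isRepresentedIn {c : PolyCode} {Km : ℕ × ℕ} (h : PosCert c Km) :
    IsRepresentedIn IsStarFreeNPolyregular c.toPoly := by
  refine isRepresentedIn_of_pieceCoeff (K := Km.1) (m := Km.2) (fun t ht i => ?_) fun b hb => ?_
  · obtain ⟨u, hu, hut⟩ := exists_mem_of_coeff_toPoly_ne_zero ht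
    rw [← hut]
    exact h.1 u hu i (List.mem_range.2 i.2)
  · have h1 := h.2 (List.ofFn b) (mem_listBox.2 ⟨by simp, fun x hx => by
      obtain ⟨i, rfl⟩ := List.mem_ofFn.1 hx
      exact Finset.mem_range.1 (Fintype.mem_piFinset.1 hb i)⟩)
    rw [isNatFrac_iff (fracVal_codeFrac _ _).1, fracVal_codeFrac_piece] at h1
    simpa using h1

theorem exists_expLt (c : PolyCode) : ∃ m, ∀ u ∈ c.2, ExpLt c.1 m u.2 := by
  refine ⟨(c.2.map fun u => ((List.range c.1).map fun i => u.2.getD i 0).sum).sum + 1,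
    fun u hu i hi => Nat.lt_succ_of_le ?_⟩
  exact (List.le_sum_of_mem (List.mem_map_of_mem (f := fun i => u.2.getD i 0) hi)).trans
    (List.le_sum_of_mem (List.mem_map_of_mem
      (f := fun u => ((List.range c.1).map fun i => u.2.getD i 0).sum) hu))

/-- Soundness of a certificate passes through representability: the piece coefficients it checks
produce a star-free function, and a represented polynomial has property 1. -/
theorem posCert_iff (c : PolyCode) :
    ScaledPolyStrNNeg c.toPoly ∧ IntegerValued c.toPoly ↔ ∃ Km, PosCert c Km := by
  constructor
  · rintro ⟨h, hP⟩
    obtain ⟨K, hK⟩ := exists_pieceCoeff_eq_natCast ((scaledPolyStrNNeg_iff _).1 h) hP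
    obtain ⟨m, hm⟩ := exists_expLt c
    refine ⟨(K, m), hm, fun b _ => ?_⟩
    rw [isNatFrac_iff (fracVal_codeFrac _ _).1, fracVal_codeFrac_piece]
    exact hK _
  · rintro ⟨Km, h⟩
    exact ((tfae_represented c.toPoly).out 0 3).2 h.isRepresentedIn

/-- Indices for the evaluation of the indeterminates with first component `false`, and for the
coefficients with respect to those with first component `true`. -/
def coeffIndex (l : List (Bool × ℕ)) : List FunIndex :=
  l.map fun q => (q.1, bif q.1 then q.2 else 0, q.2)

/-- The exponents `e`, for those of the `k` indeterminates that are not evaluated. -/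
def maskExp (k : ℕ) (l : List (Bool × ℕ)) (e : List ℕ) : List (Bool × ℕ) :=
  (List.range k).map fun i => ((l.getD i (false, 0)).1,
    bif (l.getD i (false, 0)).1 then e.getD i 0 else (l.getD i (false, 0)).2)

/-- The exponents in `l` are at most those in `e`. -/
def MaskLe (k : ℕ) (l : List (Bool × ℕ)) (e : List ℕ) : Prop :=
  ∀ i ∈ List.range k, (l.getD i (false, 0)).1 = false ∨ (l.getD i (false, 0)).2 ≤ e.getD i 0

/-- The exponents in `l` are at least those in `e`. -/
def MaskGe (k : ℕ) (l : List (Bool × ℕ)) (e : List ℕ) : Prop :=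
  ∀ i ∈ List.range k, (l.getD i (false, 0)).1 = false ∨ e.getD i 0 ≤ (l.getD i (false, 0)).2

/-- The certificates for the failure of integrality, or of the membership in `PolyStrNNeg`. -/
def NegCert (c : PolyCode) (l : List (Bool × ℕ)) : Prop :=
  NotIntFrac (codeFrac c (l.map fun q => (false, 0, q.2))) ∨
    ((codeFrac c (coeffIndex l)).1 < (codeFrac c (coeffIndex l)).2.1 ∧
      ∀ u ∈ c.2, ¬ MaskLe c.1 l u.2 ∨ MaskGe c.1 l u.2 ∨
        (codeFrac c (coeffIndex (maskExp c.1 l u.2))).1 =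
          (codeFrac c (coeffIndex (maskExp c.1 l u.2))).2.1)

theorem fracVal_eval (c : PolyCode) (l : List (Bool × ℕ)) :
    fracVal (codeFrac c (l.map fun q => (false, 0, q.2))) =
      MvPolynomial.eval (fun i : Fin c.1 => ((l.getD i (false, 0)).2 : ℚ)) c.toPoly := by
  rw [(fracVal_codeFrac _ _).2, eval_eq_prodFun]
  congr 1
  congr 1
  funext i t
  rw [List.getD_map (f := fun q : Bool × ℕ => ((false, 0, q.2) : FunIndex)) (d := (false, 0))]
  simp [FunIndex.val, newtonCoeff_zero_right]

theorem fracVal_coeff (c : PolyCode) (l : List (Bool × ℕ)) (ν : Fin c.1 → Option ℕ)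
    (s : {i // ν i = none} →₀ ℕ)
    (h : ∀ i v, ν i = some v → l.getD i (false, 0) = (false, v))
    (h' : ∀ i : {i // ν i = none}, l.getD i (false, 0) = (true, s i)) :
    fracVal (codeFrac c (coeffIndex l)) = (restrict ν c.toPoly).coeff s := by
  classical
  rw [(fracVal_codeFrac _ _).2, coeff_eq_prodFun, prodFun_restrict]
  congr 1
  congr 1
  funext i t
  have h0 : ((false, 0, 0) : FunIndex) =
    (fun q : Bool × ℕ => ((q.1, bif q.1 then q.2 else 0, q.2) : FunIndex)) (false, 0) := rfl
  rw [coeffIndex, h0, List.getD_map]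
  obtain hi | ⟨v, hi⟩ := Option.eq_none_or_eq_some (ν i)
  · rw [extendFun_none hi, h' ⟨i, hi⟩]
    simp [FunIndex.val]
  · rw [extendFun_some hi, h i v hi]
    simp [FunIndex.val, newtonCoeff_zero_right]

theorem fracVal_neg_iff {s : ℕ × ℕ × ℕ} (hs : 0 < s.2.2) : fracVal s < 0 ↔ s.1 < s.2.1 := by
  have hd : (0 : ℚ) < s.2.2 := by exact_mod_cast hs
  rw [fracVal, div_lt_iff₀ hd, zero_mul, sub_neg, Nat.cast_lt]

theorem fracVal_eq_zero_iff {s : ℕ × ℕ × ℕ} (hs : 0 < s.2.2) : fracVal s = 0 ↔ s.1 = s.2.1 := by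
  have hd : (s.2.2 : ℚ) ≠ 0 := by exact_mod_cast hs.ne'
  rw [fracVal, div_eq_zero_iff, or_iff_left hd, sub_eq_zero, Nat.cast_inj]

theorem maskExp_getD (k : ℕ) (l : List (Bool × ℕ)) (e : List ℕ) (i : Fin k) :
    (maskExp k l e).getD i (false, 0) = ((l.getD i (false, 0)).1,
      bif (l.getD i (false, 0)).1 then e.getD i 0 else (l.getD i (false, 0)).2) := by
  rw [maskExp, List.getD_eq_getElem _ _ (by simp), List.getElem_map, List.getElem_range]

/-- A list of pairs encodes a partial valuation together with an exponent of the remaining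
indeterminates. Maximality is tested only against exponents listed in the code, as every monomial of
the restriction comes from one of them; those whose coefficient in the restriction cancels are
excused. -/
theorem negCert_iff (c : PolyCode) :
    ¬ (ScaledPolyStrNNeg c.toPoly ∧ IntegerValued c.toPoly) ↔ ∃ l, NegCert c l := by
  classical
  have hmask : ∀ (l : List (Bool × ℕ)) (ν : Fin c.1 → Option ℕ) (s t : {i // ν i = none} →₀ ℕ)
      (u : (ℤ × ℕ) × List ℕ) (_ : ∀ i v, ν i = some v → l.getD i (false, 0) = (false, v))
      (_ : ∀ i : {i // ν i = none}, l.getD i (false, 0) = (true, s i))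
      (_ : ∀ i : {i // ν i = none}, u.2.getD i 0 = t i),
      (MaskLe c.1 l u.2 ↔ s ≤ t) ∧ (MaskGe c.1 l u.2 ↔ t ≤ s) ∧
      ((codeFrac c (coeffIndex (maskExp c.1 l u.2))).1 =
          (codeFrac c (coeffIndex (maskExp c.1 l u.2))).2.1 ↔
        (restrict ν c.toPoly).coeff t = 0) := by
    intro l ν s t u h h' hu
    refine ⟨⟨fun hle i => ?_, fun hle i hi => ?_⟩, ⟨fun hle i => ?_, fun hle i hi => ?_⟩, ?_⟩
    · have := hle i (List.mem_range.2 i.1.2)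
      rw [h' i, hu i] at this
      simpa using this
    · obtain hν | ⟨v, hν⟩ := Option.eq_none_or_eq_some (ν ⟨i, List.mem_range.1 hi⟩)
      · have h1 := h' ⟨_, hν⟩
        have h2 := hu ⟨_, hν⟩
        simp only at h1 h2
        rw [h1, h2]
        exact Or.inr (hle _)
      · have h1 := h _ _ hν
        simp only at h1
        rw [h1]
        exact Or.inl rfl
    · have := hle i (List.mem_range.2 i.1.2)
      rw [h' i, hu i] at this
      simpa using this
    · obtain hν | ⟨v, hν⟩ := Option.eq_none_or_eq_some (ν ⟨i, List.mem_range.1 hi⟩)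
      · have h1 := h' ⟨_, hν⟩
        have h2 := hu ⟨_, hν⟩
        simp only at h1 h2
        rw [h1, h2]
        exact Or.inr (hle _)
      · have h1 := h _ _ hν
        simp only at h1
        rw [h1]
        exact Or.inl rfl
    · rw [← fracVal_eq_zero_iff (fracVal_codeFrac _ _).1, fracVal_coeff c _ ν t]
      · intro i v hi
        rw [maskExp_getD, h i v hi]
        rfl
      · intro i
        rw [maskExp_getD, h' i, hu i]
        rfl
  rw [scaledPolyStrNNeg_iff]
  constructor
  · intro hnot
    rw [not_and_or] at hnot
    rcases hnot with hnot | hnot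
    · rw [StronglyNonneg] at hnot
      simp only [MaximalNonneg] at hnot
      push Not at hnot
      obtain ⟨ν, s, hs, hneg⟩ := hnot
      set l : List (Bool × ℕ) := List.ofFn fun i => match h : ν i with
        | some v => (false, v)
        | none => (true, s ⟨i, h⟩) with hl
      have h : ∀ i v, ν i = some v → l.getD i (false, 0) = (false, v) := by
        intro i v hi
        rw [hl, List.getD_eq_getElem _ _ (by simp), List.getElem_ofFn]
        simp only [Fin.eta]
        split <;> simp_all
      have h' : ∀ i : {i // ν i = none}, l.getD i (false, 0) = (true, s i) := by
        intro i
        have hi := i.2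
        rw [hl, List.getD_eq_getElem _ _ (by simp), List.getElem_ofFn]
        simp only [Fin.eta]
        split <;> simp_all
      refine ⟨l, Or.inr ⟨?_, fun u _ => ?_⟩⟩
      · rw [← fracVal_neg_iff (fracVal_codeFrac _ _).1, fracVal_coeff c l ν s h h']
        exact hneg
      · obtain ⟨h1, h2, h3⟩ := hmask l ν s
          (Finsupp.equivFunOnFinite.symm fun i => u.2.getD i 0) u h h' fun i => rfl
        rw [h1, h2, h3]
        by_contra! hcon
        exact hcon.2.1 (hs.2 (MvPolynomial.mem_support_iff.2 hcon.2.2) hcon.1)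
    -- Non-integrality at an integer point implies non-integrality at some natural point, so
    -- certificates need only natural coordinates.
    · have : ¬ ∀ x : Fin c.1 → ℕ, ∃ m : ℤ,
          MvPolynomial.eval (fun i => (x i : ℚ)) c.toPoly = m := fun h => hnot (.of_nat h)
      push Not at this
      obtain ⟨x, hx⟩ := this
      refine ⟨List.ofFn fun i => (false, x i), Or.inl ?_⟩
      rw [notIntFrac_iff (fracVal_codeFrac _ _).1, fracVal_eval]
      rintro ⟨m, hm⟩
      refine hx m ?_
      rw [← hm]
      congr 2
      funext i
      rw [List.getD_eq_getElem _ _ (by simp), List.getElem_ofFn]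
  · rintro ⟨l, hl | ⟨hneg, hmax⟩⟩ ⟨hP, hint⟩
    · rw [notIntFrac_iff (fracVal_codeFrac _ _).1, fracVal_eval] at hl
      exact hl (hint fun i => ((l.getD i (false, 0)).2 : ℤ))
    -- Any list decodes to a valuation and an exponent: entries marked `true` are free, and missing
    -- entries default to the evaluation at `0`.
    · set ν : Fin c.1 → Option ℕ := fun i =>
        if (l.getD i (false, 0)).1 then none else some (l.getD i (false, 0)).2 with hν
      set s : {i // ν i = none} →₀ ℕ :=
        Finsupp.equivFunOnFinite.symm fun i => (l.getD i (false, 0)).2 with hs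
      have h : ∀ i v, ν i = some v → l.getD i (false, 0) = (false, v) := by
        intro i v hi
        simp only [hν] at hi
        split_ifs at hi with h0
        exact Prod.ext (by simpa using h0) (Option.some_injective _ hi)
      have h' : ∀ i : {i // ν i = none}, l.getD i (false, 0) = (true, s i) := by
        intro i
        have hi := i.2
        simp only [hν] at hi
        split_ifs at hi with h0
        exact Prod.ext h0 rfl
      rw [← fracVal_neg_iff (fracVal_codeFrac _ _).1, fracVal_coeff c l ν s h h'] at hneg
      refine not_le.2 hneg (hP ν s ⟨MvPolynomial.mem_support_iff.2 hneg.ne, fun t ht hst => ?_⟩)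
      obtain ⟨u, hu, hut⟩ : ∃ u ∈ c.2, ∀ i : {i // ν i = none}, u.2.getD i 0 = t i := by
        by_contra! hne
        refine MvPolynomial.mem_support_iff.1 ht ?_
        rw [coeff_eq_prodFun, prodFun_restrict, prodFun_toPoly]
        refine List.sum_eq_zero fun x hx => ?_
        obtain ⟨u, hu, rfl⟩ := List.mem_map.1 hx
        obtain ⟨i, hi⟩ := hne u hu
        rw [Finset.prod_eq_zero (Finset.mem_univ i.1), mul_zero]
        rw [extendFun_none i.2, if_neg hi]
      obtain ⟨h1, h2, h3⟩ := hmask l ν s t u h h' hut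
      have := hmax u hu
      rw [h1, h2, h3] at this
      rcases this with h4 | h4 | h4
      · exact absurd hst h4
      · exact h4
      · exact absurd h4 (MvPolynomial.mem_support_iff.1 ht)

/-! ### Certificates are checked primitive recursively -/

section Primrec

theorem primrecRel_posCert : PrimrecRel PosCert := by
  have h1 : PrimrecRel fun (u : (ℤ × ℕ) × List ℕ) (p : PolyCode × ℕ × ℕ) =>
      ExpLt p.1.1 p.2.2 u.2 := by
    have h : PrimrecRel fun (i : ℕ) (q : List ℕ × ℕ) => q.1.getD i 0 < q.2 :=
      Primrec.nat_lt.comp ((Primrec.list_getD 0).comp (Primrec.fst.comp Primrec.snd) Primrec.fst)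
        (Primrec.snd.comp Primrec.snd)
    exact h.forall_mem_list.comp
      (Primrec.list_range.comp (Primrec.fst.comp (Primrec.fst.comp Primrec.snd)))
      (Primrec.pair (Primrec.snd.comp Primrec.fst)
        (Primrec.snd.comp (Primrec.snd.comp Primrec.snd)))
  have h2 : PrimrecPred IsNatFrac :=
    (Primrec.nat_le.comp (Primrec.fst.comp Primrec.snd) Primrec.fst).and
      (Primrec.eq.comp (Primrec.nat_mod.comp (Primrec.nat_sub.comp Primrec.fst
        (Primrec.fst.comp Primrec.snd)) (Primrec.snd.comp Primrec.snd)) (Primrec.const 0))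
  have h3 : PrimrecRel fun (b : List ℕ) (p : PolyCode × ℕ × ℕ) =>
      IsNatFrac (codeFrac p.1 (b.map fun x => (false, x - p.2.1, min x p.2.1))) := by
    refine h2.comp (primrec_codeFrac.comp (Primrec.fst.comp Primrec.snd)
      (Primrec.list_map Primrec.fst ?_))
    have hK : Primrec fun q : (List ℕ × PolyCode × ℕ × ℕ) × ℕ => q.1.2.2.1 :=
      Primrec.fst.comp (Primrec.snd.comp (Primrec.snd.comp Primrec.fst))
    exact Primrec.pair (Primrec.const false) (Primrec.pair
      (Primrec.nat_sub.comp Primrec.snd hK) (Primrec.nat_min.comp Primrec.snd hK))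
  exact (h1.forall_mem_list.comp (Primrec.snd.comp Primrec.fst) Primrec.id).and
    (h3.forall_mem_list.comp (primrec_listBox.comp
      (Primrec.nat_add.comp (Primrec.fst.comp Primrec.snd) (Primrec.snd.comp Primrec.snd))
      (Primrec.fst.comp Primrec.fst)) Primrec.id)

theorem primrec_coeffIndex : Primrec coeffIndex :=
  Primrec.list_map Primrec.id (Primrec.pair (Primrec.fst.comp Primrec.snd) (Primrec.pair
    (Primrec.cond (Primrec.fst.comp Primrec.snd) (Primrec.snd.comp Primrec.snd) (Primrec.const 0))
    (Primrec.snd.comp Primrec.snd)))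

theorem primrec_maskExp :
    Primrec fun p : ℕ × List (Bool × ℕ) × List ℕ => maskExp p.1 p.2.1 p.2.2 := by
  have hl : Primrec fun q : (ℕ × List (Bool × ℕ) × List ℕ) × ℕ =>
      q.1.2.1.getD q.2 (false, 0) :=
    (Primrec.list_getD _).comp (Primrec.fst.comp (Primrec.snd.comp Primrec.fst)) Primrec.snd
  exact Primrec.list_map (Primrec.list_range.comp Primrec.fst)
    (Primrec.pair (Primrec.fst.comp hl) (Primrec.cond (Primrec.fst.comp hl)
      ((Primrec.list_getD 0).comp (Primrec.snd.comp (Primrec.snd.comp Primrec.fst)) Primrec.snd)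
      (Primrec.snd.comp hl)))

theorem primrecPred_maskLe :
    PrimrecPred fun p : ℕ × List (Bool × ℕ) × List ℕ => MaskLe p.1 p.2.1 p.2.2 := by
  have h : PrimrecRel fun (i : ℕ) (q : List (Bool × ℕ) × List ℕ) =>
      (q.1.getD i (false, 0)).1 = false ∨ (q.1.getD i (false, 0)).2 ≤ q.2.getD i 0 := by
    have hl : Primrec fun p : ℕ × List (Bool × ℕ) × List ℕ => p.2.1.getD p.1 (false, 0) :=
      (Primrec.list_getD _).comp (Primrec.fst.comp Primrec.snd) Primrec.fst
    exact (Primrec.eq.comp (Primrec.fst.comp hl) (Primrec.const false)).or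
      (Primrec.nat_le.comp (Primrec.snd.comp hl)
        ((Primrec.list_getD 0).comp (Primrec.snd.comp Primrec.snd) Primrec.fst))
  exact h.forall_mem_list.comp (Primrec.list_range.comp Primrec.fst) Primrec.snd

theorem primrecPred_maskGe :
    PrimrecPred fun p : ℕ × List (Bool × ℕ) × List ℕ => MaskGe p.1 p.2.1 p.2.2 := by
  have h : PrimrecRel fun (i : ℕ) (q : List (Bool × ℕ) × List ℕ) =>
      (q.1.getD i (false, 0)).1 = false ∨ q.2.getD i 0 ≤ (q.1.getD i (false, 0)).2 := by
    have hl : Primrec fun p : ℕ × List (Bool × ℕ) × List ℕ => p.2.1.getD p.1 (false, 0) :=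
      (Primrec.list_getD _).comp (Primrec.fst.comp Primrec.snd) Primrec.fst
    exact (Primrec.eq.comp (Primrec.fst.comp hl) (Primrec.const false)).or
      (Primrec.nat_le.comp ((Primrec.list_getD 0).comp (Primrec.snd.comp Primrec.snd) Primrec.fst)
        (Primrec.snd.comp hl))
  exact h.forall_mem_list.comp (Primrec.list_range.comp Primrec.fst) Primrec.snd

theorem primrecRel_negCert : PrimrecRel NegCert := by
  have h1 : PrimrecPred NotIntFrac :=
    (Primrec.eq.comp (Primrec.nat_mod.comp (Primrec.nat_add.comp
      (Primrec.nat_sub.comp Primrec.fst (Primrec.fst.comp Primrec.snd))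
      (Primrec.nat_sub.comp (Primrec.fst.comp Primrec.snd) Primrec.fst))
      (Primrec.snd.comp Primrec.snd)) (Primrec.const 0)).not
  have h2 : PrimrecRel fun (u : (ℤ × ℕ) × List ℕ) (p : PolyCode × List (Bool × ℕ)) =>
      ¬ MaskLe p.1.1 p.2 u.2 ∨ MaskGe p.1.1 p.2 u.2 ∨
        (codeFrac p.1 (coeffIndex (maskExp p.1.1 p.2 u.2))).1 =
          (codeFrac p.1 (coeffIndex (maskExp p.1.1 p.2 u.2))).2.1 := by
    have ht : Primrec fun q : ((ℤ × ℕ) × List ℕ) × PolyCode × List (Bool × ℕ) =>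
        (q.2.1.1, q.2.2, q.1.2) :=
      Primrec.pair (Primrec.fst.comp (Primrec.fst.comp Primrec.snd))
        (Primrec.pair (Primrec.snd.comp Primrec.snd) (Primrec.snd.comp Primrec.fst))
    have hf := primrec_codeFrac.comp (Primrec.fst.comp Primrec.snd)
      (primrec_coeffIndex.comp (primrec_maskExp.comp ht))
    exact (primrecPred_maskLe.comp ht).not.or ((primrecPred_maskGe.comp ht).or
      (Primrec.eq.comp (Primrec.fst.comp hf) (Primrec.fst.comp (Primrec.snd.comp hf))))
  have h3 : Primrec fun p : PolyCode × List (Bool × ℕ) =>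
      p.2.map fun q => ((false, 0, q.2) : FunIndex) :=
    Primrec.list_map Primrec.snd (Primrec.pair (Primrec.const false)
      (Primrec.pair (Primrec.const 0) (Primrec.snd.comp Primrec.snd)))
  have h4 : Primrec fun p : PolyCode × List (Bool × ℕ) => codeFrac p.1 (coeffIndex p.2) :=
    primrec_codeFrac.comp Primrec.fst (primrec_coeffIndex.comp Primrec.snd)
  exact (h1.comp (primrec_codeFrac.comp Primrec.fst h3)).or
    ((Primrec.nat_lt.comp (Primrec.fst.comp h4) (Primrec.fst.comp (Primrec.snd.comp h4))).and
      (h2.forall_mem_list.comp (Primrec.snd.comp Primrec.fst) Primrec.id))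

end Primrec

theorem isDecidable_scaledPolyStrNNeg :
    IsDecidable fun _ P => ScaledPolyStrNNeg P ∧ IntegerValued P :=
  computablePred_of_exists primrecRel_posCert primrecRel_negCert posCert_iff negCert_iff

end Certificates

end NRatPoly

theorem mainTheorem4 :
    (∀ (k : ℕ) (P : MvPolynomial (Fin k) ℚ),
      List.TFAE [
        ScaledPolyStrNNeg P ∧ IntegerValued P,
        IsRepresentedIn IsNRational P,
        IsRepresentedIn IsNPolyregular P,
        IsRepresentedIn IsStarFreeNPolyregular P,
        IsStronglyNaturalBinomial P]) ∧
    IsDecidable (fun _ P => ScaledPolyStrNNeg P ∧ IntegerValued P) ∧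
    IsDecidable (fun _ P => IsRepresentedIn IsNRational P) ∧
    IsDecidable (fun _ P => IsRepresentedIn IsNPolyregular P) ∧
    IsDecidable (fun _ P => IsRepresentedIn IsStarFreeNPolyregular P) ∧
    IsDecidable (fun _ P => IsStronglyNaturalBinomial P) := by
  have h := isDecidable_scaledPolyStrNNeg
  exact ⟨fun _ P => tfae_represented P, h,
    h.of_eq fun c => (tfae_represented c.toPoly).out 0 1,
    h.of_eq fun c => (tfae_represented c.toPoly).out 0 2,
    h.of_eq fun c => (tfae_represented c.toPoly).out 0 3,
    h.of_eq fun c => (tfae_represented c.toPoly).out 0 4⟩
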